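/- **Setting.** Let $X=\mu^{-1}(\eta)/U(1)^r$ be a toric Calabi–Yau threefold, i.e. the Kähler quotient of $\mathbb C^{N}$, $N=r+3$, with integer charge matrix $Q=(Q_i^a)$, $\sum_i Q_i^a=0$ for all $a$, at a regular value $\eta$ of the moment map $\mu^a=\sum_i Q_i^a|z^i|^2$ (orbifold points are allowed). Let $D_I$ be the compact toric divisors among the $D_i=\{z^i=0\}$; assume there is at least one, i.e. $H^2_{\rm comp}(X)\neq0$. Put $(\psi\cdot m)^a=-\sum_I Q_I^a m^I$ and $x_i=\epsilon_i+\sum_a Q_i^a\phi_a$. For generic equivariant parameters $\epsilon\in\mathbb C^N$ with $\epsilon_I=0$ along the compact divisors, and $t\in\mathbb C^r$, let $$\mathcal F_\epsilon(t)=\oint_C\prod_a\frac{d\phi_a}{2\pi i}\,\frac{e^{\sum_a t^a\phi_a}}{\prod_i x_i},\qquad \mathcal C_\epsilon(t)=\frac1{12}\oint_C\prod_a\frac{d\phi_a}{2\pi i}\,\frac{e^{\sum_a t^a\phi_a}}{\prod_i x_i}\sum_{i<j}x_ix_j,$$ where $C$ is the Jeffrey–Kirwan contour of the chamber of $\eta$,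 kept fixed: the integral is the sum of the residues at those points $\{x_j=0,\ j\in J\}$ for which the $r$ columns $(Q_j)_{j\in J}$ form a basis of $\mathbb R^r$ whose cone contains $\eta$, normalised so that $\prod_a d\phi_a/\prod_{j\in J}x_j$ has residue $1/|\det Q_J|$. Below, $O(\epsilon)$ denotes a function of $\epsilon$ that extends analytically to $\epsilon=0$ and vanishes there (all other parameters being fixed). **Shift polynomials.** There are a unique homogeneous cubic polynomial $P_3(t,m)$ and a unique homogeneous linear polynomial $P_1(m)$ such that for all $t,m$ $$\mathcal F_\epsilon(t)-\mathcal F_\epsilon(t+\psi\cdot m)=P_3(t,m)+O(\epsilon),\qquad \mathcal C_\epsilon(t)-\mathcal C_\epsilon(t+\psi\cdot m)=P_1(m)+O(\epsilon).$$ Let $P_{p,q}$ be the part of $P_3$ of degree $p$ in $t$ and $q$ in $m$, and let $\mathcal P^{CY_3}(t,m;1)=P_3(t,m)+P_1(m)$. **Factorization.** Let $n\ge1$, let $\alpha^1,\dots,\alpha^n$ be vectors $\alpha^p=(\alpha^{Ip})_I$ with $\sum_p\alpha^p=0$, and let $g,\varepsilon\in\mathbb C$. Put $$g_p=g+\tfrac\varepsilon2(n+1-2p),\quad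 \sigma^p=\sum_{s<p}\alpha^s-\sum_{s>p}\alpha^s,\quad t^p=t+\psi\cdot\bigl(g_p\alpha^p+\tfrac\varepsilon2\sigma^p\bigr),$$ $$u_n(\alpha;g,t)=\frac{n\,\mathcal F_\epsilon(t)}{(n\varepsilon/2)^2-g^2}+\sum_{p=1}^nP_{1,2}(t,\alpha^p)+g\sum_{p=1}^nP_{0,3}(\alpha^p)-\frac n2\,\mathcal C_\epsilon(t),$$ and assume $(n\varepsilon/2)^2\ne g^2$ and $(\varepsilon/2)^2\neq g_p^2$ for all $p$. Then, for every $t$, $$u_n(\alpha;g,t)+\frac\varepsilon2\sum_{q<p}\mathcal P^{CY_3}(0,\alpha^q-\alpha^p;1)=\sum_{p=1}^nu_1(0;g_p,t^p)+O(\epsilon).$$ Moreover the identity holds exactly, without the $O(\epsilon)$, if in the definition of $u_n$ and $u_1$ the functions $\mathcal F_\epsilon,\mathcal C_\epsilon$ are replaced by any truncations $\hat{\mathcal F},\hat{\mathcal C}$ that solve the shift equations exactly, $\hat{\mathcal F}(s)-\hat{\mathcal F}(s+\psi\cdot m)=P_3(s,m)$ and $\hat{\mathcal C}(s)-\hat{\mathcal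 C}(s+\psi\cdot m)=P_1(m)$, whenever $s$ and $s+\psi\cdot m$ lie in a set $U$ (such as a chamber) that contains $t,t^1,\dots,t^n$. Polynomial truncations of this kind exist on all of $\mathbb C^r$. -/

import Mathlib

/-- Combinatorial data of a toric Calabi-Yau threefold `X = μ⁻¹(η) / T`, the Kähler quotient of
`ℂ^(r+3)` by the torus `T = U(1)^r` acting with charge matrix `Q`.
The Calabi-Yau condition is that every row of `Q` sums to zero. The level `η` is a regular value of
the moment map `μ(z)^a = ∑ i, Q a i * |z i|^2`: at every point of `μ⁻¹(η)` the columns `Q_i` with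
`z i ≠ 0` span `ℝ^r`, i.e. `T` acts on `μ⁻¹(η)` with finite stabilizers. The level `η` singles out
a chamber of the Kähler parameters. (If all stabilizers are trivial then `X` is a manifold; in
general `X` may have orbifold points.) -/
structure ToricCY3 (r : ℕ) where
  /-- the charge matrix -/
  Q : Matrix (Fin r) (Fin (r + 3)) ℤ
  calabiYau : ∀ a, ∑ i, Q a i = 0
  /-- a point of the chamber -/
  η : Fin r → ℝ
  regular : ∀ p : Fin (r + 3) → ℝ, (∀ i, 0 ≤ p i) → (∀ a, ∑ i, (Q a i : ℝ) * p i = η a) →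
    Submodule.span ℝ {v : Fin r → ℝ | ∃ i, p i ≠ 0 ∧ v = fun a => (Q a i : ℝ)} = ⊤

namespace ToricCY3

variable {r : ℕ} (X : ToricCY3 r)

/-- The image of the toric divisor `D_i = {z i = 0} ⊆ X` under `p i = |z i|^2`. The divisor `D_i`
is compact if and only if this face of the moment polyhedron is. -/
def divisorImage (i : Fin (r + 3)) : Set (Fin (r + 3) → ℝ) :=
  {p | (∀ j, 0 ≤ p j) ∧ (∀ a, ∑ j, (X.Q a j : ℝ) * p j = X.η a) ∧ p i = 0}

open Classical in
/-- The set of indices `I` of the (nonempty) compact toric divisors. Their Poincaré duals generate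
`H²_comp(X)`. -/
noncomputable def compactDivisors : Finset (Fin (r + 3)) :=
  Finset.univ.filter fun i => (X.divisorImage i).Nonempty ∧ IsCompact (X.divisorImage i)

/-- `ψ = -(Q_I^a) : H²_comp(X) → H²(X)`. -/
noncomputable def ψ (m : X.compactDivisors → ℂ) : Fin r → ℂ :=
  fun a => -∑ I : X.compactDivisors, (X.Q a I : ℂ) * m I

/-! ### Jeffrey-Kirwan residues and the equivariant volume -/

/-- The linear functions `x_i = ε_i + ∑ a, Q_i^a φ_a`. -/
noncomputable def x (ε : Fin (r + 3) → ℂ) (φ : Fin r → ℂ) (i : Fin (r + 3)) : ℂ :=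
  ε i + ∑ a, (X.Q a i : ℂ) * φ a

/-- The square submatrix of `Q` with columns `J 0, J 1, …`. -/
def Qsub (J : Fin r → Fin (r + 3)) : Matrix (Fin r) (Fin r) ℤ := X.Q.submatrix id J

open Classical in
/-- The poles selected by the Jeffrey-Kirwan prescription: the sets `J` of `r` columns of `Q`
(listed increasingly) that are a basis of `ℝ^r` and whose cone contains `η`. They correspond to the
torus-fixed points of `X`. -/
noncomputable def vertices : Finset (Fin r → Fin (r + 3)) :=
  Finset.univ.filter fun J => StrictMono J ∧ (X.Qsub J).det ≠ 0 ∧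
    ∃ c : Fin r → ℝ, (∀ k, 0 ≤ c k) ∧ ∀ a, ∑ k, (X.Qsub J a k : ℝ) * c k = X.η a

/-- The pole attached to `J`: the solution `φ` of `x_j(φ) = 0` for all `j` in `J`. -/
noncomputable def pole (J : Fin r → Fin (r + 3)) (ε : Fin (r + 3) → ℂ) : Fin r → ℂ :=
  -Matrix.vecMul (fun k => ε (J k)) ((X.Qsub J).map (Int.cast : ℤ → ℂ))⁻¹

open Classical in
/-- The integral `∮_C ∏_a dφ_a/(2πi) f(φ) / ∏_i x_i(φ)` over the Jeffrey-Kirwan contour `C` of the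
chamber of `η`, for `f` entire and `ε` generic: the sum over the selected poles of the
Jeffrey-Kirwan residues, the residue of `∏_a dφ_a / ∏_{j ∈ J} x_j` being `1 / |det Q_J|`. -/
noncomputable def jkIntegral (ε : Fin (r + 3) → ℂ) (f : (Fin r → ℂ) → ℂ) : ℂ :=
  ∑ J ∈ X.vertices, f (X.pole J ε) /
    (((|(X.Qsub J).det| : ℤ) : ℂ) *
      ∏ i ∈ Finset.univ.filter (fun i => i ∉ Set.range J), X.x ε (X.pole J ε) i)

/-- The equivariant volume `F_ε(t)` (continued in `t` from the chamber of `η`, the contour being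
kept fixed). -/
noncomputable def vol (ε : Fin (r + 3) → ℂ) (t : Fin r → ℂ) : ℂ :=
  X.jkIntegral ε fun φ => Complex.exp (∑ a, t a * φ a)

/-- `c_2 = ∑_{i < j} x_i x_j`. -/
noncomputable def c2 (ε : Fin (r + 3) → ℂ) (φ : Fin r → ℂ) : ℂ :=
  ∑ i, ∑ j ∈ Finset.Ioi i, X.x ε φ i * X.x ε φ j

/-- The `c_2` term `C_ε(t)`. -/
noncomputable def c2Vol (ε : Fin (r + 3) → ℂ) (t : Fin r → ℂ) : ℂ :=
  1 / 12 * X.jkIntegral ε fun φ => Complex.exp (∑ a, t a * φ a) * X.c2 ε φ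

/-! ### Equality up to `O(ε)` and the shift polynomials -/

/-- Admissible equivariant parameters: `ε_I = 0` along the compact divisors, and otherwise generic,
in the sense that every selected pole is a transverse intersection of exactly `r` of the
hyperplanes `x_i = 0`. -/
def Admissible (ε : Fin (r + 3) → ℂ) : Prop :=
  (∀ I ∈ X.compactDivisors, ε I = 0) ∧
    ∀ J ∈ X.vertices, ∀ i, i ∉ Set.range J → X.x ε (X.pole J ε) i ≠ 0

/-- `E(ε) = O(ε)`: on admissible `ε` near `0`, the function `E` agrees with a function that is
regular (analytic) at `ε = 0` and vanishes there. -/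
def IsOε (E : (Fin (r + 3) → ℂ) → ℂ) : Prop :=
  ∃ G : (Fin (r + 3) → ℂ) → ℂ, AnalyticAt ℂ G 0 ∧ G 0 = 0 ∧
    ∀ᶠ ε in nhds 0, X.Admissible ε → E ε = G ε

/-- `P` is the cubic shift polynomial `P_3(t, m)` of `X`: homogeneous of degree three in `(t, m)`
with `F_ε(t) - F_ε(t + ψ·m) = P_3(t, m) + O(ε)`. -/
def IsCubicShift (P : MvPolynomial (Fin r ⊕ X.compactDivisors) ℂ) : Prop :=
  P.IsHomogeneous 3 ∧ ∀ t m,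
    X.IsOε fun ε => X.vol ε t - X.vol ε (t + X.ψ m) - MvPolynomial.eval (Sum.elim t m) P

/-- `P` is the linear shift polynomial `P_1(m)` of `X`: homogeneous of degree one in `m` with
`C_ε(t) - C_ε(t + ψ·m) = P_1(m) + O(ε)`. -/
def IsLinearShift (P : MvPolynomial X.compactDivisors ℂ) : Prop :=
  P.IsHomogeneous 1 ∧ ∀ t m,
    X.IsOε fun ε => X.c2Vol ε t - X.c2Vol ε (t + X.ψ m) - MvPolynomial.eval m P

/-- The part of `P(t, m)` of degree `p` in `t` and degree `q` in `m`. -/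
noncomputable def bidegreePart {A B : Type*} (p q : ℕ) (P : MvPolynomial (A ⊕ B) ℂ) :
    MvPolynomial (A ⊕ B) ℂ :=
  MvPolynomial.weightedHomogeneousComponent (Sum.elim (fun _ => 1) (fun _ => 0) : A ⊕ B → ℕ) p
    (MvPolynomial.weightedHomogeneousComponent (Sum.elim (fun _ => 0) (fun _ => 1) : A ⊕ B → ℕ) q P)

/-- `P(T, M; 1) = P_3(T, M) + P_1(M)`. -/
noncomputable def quantumShift (P₃ : MvPolynomial (Fin r ⊕ X.compactDivisors) ℂ)
    (P₁ : MvPolynomial X.compactDivisors ℂ) (T : Fin r → ℂ) (M : X.compactDivisors → ℂ) : ℂ :=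
  MvPolynomial.eval (Sum.elim T M) P₃ + MvPolynomial.eval M P₁

/-! ### The classical action -/

/-- The classical `U(n)` action `u_n(α; g, t)` built from the functions `F` (the equivariant volume
or a truncation) and `C` (the `c_2` term or a truncation), the cubic shift polynomial and the
coupling `e`. -/
noncomputable def classicalAction (P₃ : MvPolynomial (Fin r ⊕ X.compactDivisors) ℂ)
    (F C : (Fin r → ℂ) → ℂ) (e : ℂ) (n : ℕ) (α : Fin n → X.compactDivisors → ℂ) (g : ℂ)
    (t : Fin r → ℂ) : ℂ :=
  n * F t / ((n * e / 2) ^ 2 - g ^ 2)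
    + ∑ p, MvPolynomial.eval (Sum.elim t (α p)) (bidegreePart 1 2 P₃)
    + g * ∑ p, MvPolynomial.eval (Sum.elim t (α p)) (bidegreePart 0 3 P₃)
    - n / 2 * C t

/-- `g_p = g + (e/2) (n + 1 - 2p)`, where `p = 1, …, n` is represented by `p - 1 : Fin n`. -/
noncomputable def gp {n : ℕ} (e g : ℂ) (p : Fin n) : ℂ :=
  g + e / 2 * (n + 1 - 2 * ((p : ℕ) + 1))

/-- `σ^p = ∑_{s < p} α^s - ∑_{s > p} α^s`. -/
noncomputable def sigma {n : ℕ} (α : Fin n → X.compactDivisors → ℂ) (p : Fin n) :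
    X.compactDivisors → ℂ :=
  ∑ s ∈ Finset.Iio p, α s - ∑ s ∈ Finset.Ioi p, α s

/-- `t^p = t + ψ·(g_p α^p + (e/2) σ^p)`. -/
noncomputable def tp {n : ℕ} (e g : ℂ) (α : Fin n → X.compactDivisors → ℂ) (t : Fin r → ℂ)
    (p : Fin n) : Fin r → ℂ :=
  t + X.ψ (gp e g p • α p + (e / 2) • X.sigma α p)

/-- Left-hand side minus right-hand side of the factorization identity
`u_n(α; g, t) + (e/2) ∑_{q < p} P(0, α^q - α^p; 1) = ∑_p u_1(0; g_p, t^p)`. -/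
noncomputable def factorizationDefect (P₃ : MvPolynomial (Fin r ⊕ X.compactDivisors) ℂ)
    (P₁ : MvPolynomial X.compactDivisors ℂ) (F C : (Fin r → ℂ) → ℂ) (e : ℂ) (n : ℕ)
    (α : Fin n → X.compactDivisors → ℂ) (g : ℂ) (t : Fin r → ℂ) : ℂ :=
  X.classicalAction P₃ F C e n α g t
    + e / 2 * ∑ p, ∑ q ∈ Finset.Iio p, X.quantumShift P₃ P₁ 0 (α q - α p)
    - ∑ p, X.classicalAction P₃ F C e 1 0 (gp e g p) (X.tp e g α t p)

end ToricCY3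

namespace ToricCY3

open Finset

variable {r : ℕ} (X : ToricCY3 r)

/-! ### Poles and linear relations between the charges -/

/-! Two mechanisms carry the proof: a residue argument on a line of parameters, and a telescoping
sum. At a vertex `J` the pole φ_J and the three weights w_i = x_i(φ_J), i ∉ J, are linear in ε. Both
integrals are fixed-point sums over the vertices, singular at ε = 0.

Regularity of the shift. Fix an admissible `d` and average the fixed-point sum of the shift over the
circle ε + z d, |z| = 1. For small ε all roots -w_i(ε)/w_i(d) lie inside, so the average is the
value at ε plus the residues at the roots. The root of w_j at `J` belongs to the edge `J ∪ {j}` of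
the moment polyhedron. If the edge has two vertices, their residues are opposite
(`Exchange.weight_eq`). If it has only one, then every compact index lies in `J ∪ {j}`
(`exists_exchange`), so all compact x_I vanish at the root; since ⟨ψ·m, φ⟩ = -∑ m^I x_I, the two
exponentials agree there and the residue is zero. Hence the shift equals the average
(`jkIntegral_numerator_eq`), which is analytic in ε near 0. At ε = 0 the average extracts a Taylor
coefficient of the exponential, so that P_3 = ∑_J (⟨t, φ_J⟩³ - ⟨t + ψ·m, φ_J⟩³) / (6 e_J), where e_J
is |det Q_J| times the product of the weights, all taken at `d`; P_1 is similar, with first powers.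
A constant that is O(ε) vanishes, which gives uniqueness.

Factorization. Given an identity between P_3 and P_1 alone (`shift_factorization`), the defect is a
combination of the defects of the shift equations from t to t^p (`factorizationDefect_eq`). As P_3
and P_1 are sums over `J` of powers of linear forms, that identity reduces to a scalar one. With h_k
= g + (e/2)(n - 2k) the denominators become -h_k h_{k+1}, and the sums telescope because the partial
sums of α vanish at both ends (`cubic_factorization`, `linear_factorization`). -/

theorem det_cast {R : Type*} [CommRing R] (J : Fin r → Fin (r + 3)) :
    ((X.Qsub J).map (Int.cast : ℤ → R)).det = ((X.Qsub J).det : R) := by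
  have := (Int.castRingHom R).map_det (X.Qsub J)
  simpa only [RingHom.mapMatrix_apply, Int.coe_castRingHom, eq_intCast] using this.symm

theorem x_pole_mem {J : Fin r → Fin (r + 3)} (hJ : (X.Qsub J).det ≠ 0) (ε : Fin (r + 3) → ℂ)
    (k : Fin r) : X.x ε (X.pole J ε) (J k) = 0 := by
  have hu : IsUnit ((X.Qsub J).map (Int.cast : ℤ → ℂ)).det := by
    rw [isUnit_iff_ne_zero, X.det_cast]
    exact_mod_cast hJ
  have h : Matrix.vecMul (X.pole J ε) ((X.Qsub J).map (Int.cast : ℤ → ℂ)) k = -ε (J k) := by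
    rw [pole, Matrix.neg_vecMul, Matrix.vecMul_vecMul, Matrix.nonsing_inv_mul _ hu,
      Matrix.vecMul_one]
    rfl
  simp only [Matrix.vecMul, dotProduct, Qsub, Matrix.map_apply, Matrix.submatrix_apply, id] at h
  rw [x, add_eq_zero_iff_eq_neg, ← neg_eq_iff_eq_neg, ← h]
  exact sum_congr rfl fun a _ => mul_comm _ _

theorem eq_pole {J : Fin r → Fin (r + 3)} (hJ : (X.Qsub J).det ≠ 0) {ε : Fin (r + 3) → ℂ}
    {φ : Fin r → ℂ} (h : ∀ k, X.x ε φ (J k) = 0) : φ = X.pole J ε := by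
  have hu : IsUnit ((X.Qsub J).map (Int.cast : ℤ → ℂ)).det := by
    rw [isUnit_iff_ne_zero, X.det_cast]
    exact_mod_cast hJ
  have h' : Matrix.vecMul φ ((X.Qsub J).map (Int.cast : ℤ → ℂ)) = -fun k => ε (J k) := by
    funext k
    have hk := h k
    rw [x, add_eq_zero_iff_eq_neg, ← neg_eq_iff_eq_neg] at hk
    simp only [Matrix.vecMul, dotProduct, Qsub, Matrix.map_apply, Matrix.submatrix_apply, id,
      Pi.neg_apply]
    rw [hk]
    exact sum_congr rfl fun a _ => mul_comm _ _
  rw [pole, ← Matrix.neg_vecMul, ← h', Matrix.vecMul_vecMul, Matrix.mul_nonsing_inv _ hu,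
    Matrix.vecMul_one]

theorem pole_add (J : Fin r → Fin (r + 3)) (ε δ : Fin (r + 3) → ℂ) :
    X.pole J (ε + δ) = X.pole J ε + X.pole J δ := by
  have : (fun k => (ε + δ) (J k)) = (fun k => ε (J k)) + fun k => δ (J k) := rfl
  rw [pole, this, Matrix.add_vecMul, neg_add]
  rfl

theorem pole_smul (J : Fin r → Fin (r + 3)) (c : ℂ) (ε : Fin (r + 3) → ℂ) :
    X.pole J (c • ε) = c • X.pole J ε := by
  have : (fun k => (c • ε) (J k)) = c • fun k => ε (J k) := rfl
  rw [pole, this, Matrix.smul_vecMul, ← smul_neg]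
  rfl

/-- The pole attached to `J`, as a linear function of the equivariant parameters. -/
noncomputable def poleL (J : Fin r → Fin (r + 3)) : (Fin (r + 3) → ℂ) →ₗ[ℂ] Fin r → ℂ where
  toFun := X.pole J
  map_add' := X.pole_add J
  map_smul' := X.pole_smul J

@[simp] theorem poleL_apply (J : Fin r → Fin (r + 3)) (ε : Fin (r + 3) → ℂ) :
    X.poleL J ε = X.pole J ε := rfl

/-- The value of `x_i` at the pole attached to `J`, as a linear function of the equivariant
parameters. -/
noncomputable def weight (J : Fin r → Fin (r + 3)) (i : Fin (r + 3)) :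
    (Fin (r + 3) → ℂ) →ₗ[ℂ] ℂ :=
  LinearMap.proj i + ∑ a, (X.Q a i : ℂ) • (LinearMap.proj a ∘ₗ X.poleL J)

theorem weight_apply (J : Fin r → Fin (r + 3)) (i : Fin (r + 3)) (ε : Fin (r + 3) → ℂ) :
    X.weight J i ε = X.x ε (X.pole J ε) i := by
  simp [weight, x, LinearMap.sum_apply]

/-- A linear relation `∑ i, v i • Q_i = 0` between the charge vectors. -/
def IsRelation {R : Type*} [CommRing R] (v : Fin (r + 3) → R) : Prop :=
  ∀ a, ∑ i, (X.Q a i : R) * v i = 0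

/-- A relation annihilates the φ-dependent part of x, so only ε survives. -/
theorem IsRelation.sum_mul_x {X : ToricCY3 r} {v : Fin (r + 3) → ℂ} (hv : X.IsRelation v)
    (ε : Fin (r + 3) → ℂ) (φ : Fin r → ℂ) : ∑ i, v i * X.x ε φ i = ∑ i, v i * ε i := by
  simp only [x, mul_add, sum_add_distrib, mul_sum]
  rw [add_eq_left, sum_comm]
  refine sum_eq_zero fun a _ => ?_
  have := congrArg (φ a * ·) (hv a)
  simp only [mul_zero, mul_sum] at this
  rw [← this]
  exact sum_congr rfl fun i _ => by ring

theorem IsRelation.ofReal {X : ToricCY3 r} {v : Fin (r + 3) → ℝ} (hv : X.IsRelation v) :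
    X.IsRelation fun i => (v i : ℂ) := fun a => by
  have := congrArg Complex.ofReal (hv a)
  simpa using this

/-- At the pole every x_i with i in `J` is zero, so the sum over the relation has only its `j` term.
Weights thereby become pairings of ε with relations. -/
theorem IsRelation.mul_weight {X : ToricCY3 r} {J : Fin r → Fin (r + 3)}
    (hJ : (X.Qsub J).det ≠ 0) {v : Fin (r + 3) → ℂ} (hv : X.IsRelation v) {j : Fin (r + 3)}
    (hvj : ∀ i, i ≠ j → i ∉ Set.range J → v i = 0) (ε : Fin (r + 3) → ℂ) :
    v j * X.weight J j ε = ∑ i, v i * ε i := by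
  rw [← hv.sum_mul_x ε (X.pole J ε), weight_apply]
  symm
  refine sum_eq_single j (fun i _ hij => ?_) fun h => absurd (mem_univ j) h
  by_cases hi : i ∈ Set.range J
  · obtain ⟨k, rfl⟩ := hi
    rw [X.x_pole_mem hJ, mul_zero]
  · rw [hvj i hij hi, zero_mul]

/-- The relation expressing the charge vector `Q_j` through the basis `(Q_i)_{i ∈ J}`. -/
theorem exists_isRelation {J : Fin r → Fin (r + 3)} (hJ : (X.Qsub J).det ≠ 0) {j : Fin (r + 3)}
    (hj : j ∉ Set.range J) :
    ∃ v : Fin (r + 3) → ℝ, X.IsRelation v ∧ v j = 1 ∧ ∀ i, i ≠ j → i ∉ Set.range J → v i = 0 := by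
  set A := (X.Qsub J).map (Int.cast : ℤ → ℝ) with hA
  have hu : IsUnit A.det := by
    rw [isUnit_iff_ne_zero, hA, X.det_cast]
    exact_mod_cast hJ
  set b := A⁻¹.mulVec fun a => (X.Q a j : ℝ) with hb
  have hAb : A.mulVec b = fun a => (X.Q a j : ℝ) := by
    rw [hb, Matrix.mulVec_mulVec, Matrix.mul_nonsing_inv _ hu, Matrix.one_mulVec]
  refine ⟨Pi.single j 1 - ∑ k, b k • Pi.single (J k) 1, fun a => ?_, ?_, fun i hij hi => ?_⟩
  · have ha := congrFun hAb a
    simp only [Matrix.mulVec, dotProduct, hA, Matrix.map_apply, Qsub, Matrix.submatrix_apply,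
      id] at ha
    simp only [Pi.sub_apply, Finset.sum_apply, Pi.smul_apply, smul_eq_mul, mul_sub,
      sum_sub_distrib, mul_sum]
    rw [sum_comm]
    simp [Pi.single_apply, ha]
  · have : ∀ k, j ≠ J k := fun k h => hj ⟨k, h.symm⟩
    simp [this]
  · have : ∀ k, i ≠ J k := fun k h => hi ⟨k, h.symm⟩
    simp [this, hij]

/-- A relation supported on a basis of charge vectors vanishes. -/
theorem IsRelation.eq_zero {X : ToricCY3 r} {J : Fin r → Fin (r + 3)} (hJ : (X.Qsub J).det ≠ 0)
    (hinj : Function.Injective J) {v : Fin (r + 3) → ℝ} (hv : X.IsRelation v)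
    (h : ∀ i, i ∉ Set.range J → v i = 0) : v = 0 := by
  have hA : ((X.Qsub J).map (Int.cast : ℤ → ℝ)).det ≠ 0 := by
    rw [X.det_cast]
    exact_mod_cast hJ
  have h0 : (fun k => v (J k)) = 0 := by
    refine Matrix.eq_zero_of_mulVec_eq_zero hA (funext fun a => ?_)
    rw [Pi.zero_apply, ← hv a]
    simp only [Matrix.mulVec, dotProduct, Matrix.map_apply, Qsub, Matrix.submatrix_apply, id]
    refine Fintype.sum_of_injective J hinj _ _ (fun i hi => ?_) (fun k => rfl)
    rw [h i hi, mul_zero]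
  funext i
  by_cases hi : i ∈ Set.range J
  · obtain ⟨k, rfl⟩ := hi
    exact congrFun h0 k
  · exact h i hi

/-- Comparison of the determinants of two bases that differ in one vector. -/
theorem abs_det_exchange {J J' : Fin r → Fin (r + 3)}
    (hinj : Function.Injective J) (hinj' : Function.Injective J') {v : Fin (r + 3) → ℝ}
    (hv : X.IsRelation v) {j j' : Fin (r + 3)} (hj : j ∉ Set.range J) (hj' : j' ∈ Set.range J)
    (hJJ' : Set.range J' = insert j (Set.range J) \ {j'}) (hvj : v j = 1)
    (hv0 : ∀ i, i ≠ j → i ∉ Set.range J → v i = 0) :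
    |((X.Qsub J').det : ℝ)| = |v j'| * |((X.Qsub J).det : ℝ)| := by
  obtain ⟨k₀, rfl⟩ := hj'
  have hne : ∀ k, J k ≠ j := fun k h => hj ⟨k, h⟩
  -- `J''` puts `j` in the slot of `j'`, whereas `J'` is another listing of the same set. The
  -- permutation `σ` between them changes the determinant only by a sign.
  set J'' := Function.update J k₀ j with hJ''
  have hinj'' : Function.Injective J'' := by
    intro k l hkl
    by_cases hk : k = k₀ <;> by_cases hl : l = k₀
    · rw [hk, hl]
    · subst hk
      simp only [hJ'', Function.update_self, Function.update_of_ne hl] at hkl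
      exact absurd hkl.symm (hne l)
    · subst hl
      simp only [hJ'', Function.update_self, Function.update_of_ne hk] at hkl
      exact absurd hkl (hne k)
    · simp only [hJ'', Function.update_of_ne hl, Function.update_of_ne hk] at hkl
      exact hinj hkl
  have hrange : Set.range J'' = Set.range J' := by
    rw [hJJ']
    ext i
    constructor
    · rintro ⟨k, rfl⟩
      by_cases hk : k = k₀
      · subst hk
        simp only [hJ'', Function.update_self]
        exact ⟨Or.inl rfl, fun h => hne k h.symm⟩
      · simp only [hJ'', Function.update_of_ne hk]
        exact ⟨Or.inr ⟨k, rfl⟩, fun h => hk (hinj h)⟩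
    · rintro ⟨rfl | ⟨k, rfl⟩, hi⟩
      · exact ⟨k₀, by simp [hJ'']⟩
      · have hk : k ≠ k₀ := fun h => hi (by rw [h]; rfl)
        exact ⟨k, by simp [hJ'', Function.update_of_ne hk]⟩
  let σ : Fin r ≃ Fin r := (Equiv.ofInjective J' hinj').trans
    ((Equiv.setCongr hrange.symm).trans (Equiv.ofInjective J'' hinj'').symm)
  have hσ : ∀ k, J'' (σ k) = J' k := fun k => by
    have := Equiv.apply_ofInjective_symm hinj'' ((Equiv.setCongr hrange.symm)
      (Equiv.ofInjective J' hinj' k))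
    simpa [σ] using this
  have h1 : |((X.Qsub J').det : ℝ)| = |((X.Qsub J'').det : ℝ)| := by
    have h : X.Qsub J' = (X.Qsub J'').submatrix id σ := by
      ext a k
      simp [Qsub, hσ]
    rw [h, Matrix.det_permute']
    rcases Int.units_eq_one_or (Equiv.Perm.sign σ) with hs | hs <;> simp [hs]
  rw [h1]
  set A := (X.Qsub J).map (Int.cast : ℤ → ℝ) with hA
  -- The relation writes Q_j through the columns of `J`; by multilinearity the determinant retains
  -- only the coefficient `-v j'` of the replaced column.
  have h2 : (X.Qsub J'').map (Int.cast : ℤ → ℝ)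
      = A.updateCol k₀ fun a => ∑ k, (-v (J k)) • A a k := by
    ext a k
    by_cases hk : k = k₀
    · subst hk
      simp only [Matrix.updateCol_self, Matrix.map_apply, Qsub, Matrix.submatrix_apply, hJ'', id,
        Function.update_self, hA, smul_eq_mul]
      have := hv a
      rw [← sum_erase_add _ _ (mem_univ j), hvj, mul_one] at this
      have h3 : ∑ i ∈ univ.erase j, (X.Q a i : ℝ) * v i = ∑ k, (X.Q a (J k) : ℝ) * v (J k) := by
        rw [← sum_image (f := fun i => (X.Q a i : ℝ) * v i) (g := J) hinj.injOn]
        symm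
        refine sum_subset (fun i hi => ?_) fun i hi hi' => ?_
        · obtain ⟨k, -, rfl⟩ := mem_image.1 hi
          exact mem_erase.2 ⟨hne k, mem_univ _⟩
        · rw [hv0 i (mem_erase.1 hi).1, mul_zero]
          rintro ⟨k, rfl⟩
          exact hi' (mem_image_of_mem J (mem_univ k))
      rw [h3] at this
      rw [eq_neg_of_add_eq_zero_right this, ← sum_neg_distrib]
      exact sum_congr rfl fun k _ => by ring
    · simp [Qsub, hJ'', hA, hk]
  rw [← X.det_cast (R := ℝ) J'', h2, Matrix.det_updateCol_sum, hA, X.det_cast, smul_eq_mul,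
    abs_mul, abs_neg]

end ToricCY3

namespace ToricCY3

open Finset

variable {r : ℕ} (X : ToricCY3 r)

/-! ### The moment polyhedron -/

/-- The moment polyhedron of `X`. -/
def polyhedron : Set (Fin (r + 3) → ℝ) :=
  {p | (∀ j, 0 ≤ p j) ∧ ∀ a, ∑ j, (X.Q a j : ℝ) * p j = X.η a}

variable {X}

theorem span_support {p : Fin (r + 3) → ℝ} (hp : p ∈ X.polyhedron) :
    Submodule.span ℝ (((univ.filter fun i => p i ≠ 0).image
      fun i => (fun a => (X.Q a i : ℝ)) : Finset (Fin r → ℝ)) : Set (Fin r → ℝ)) = ⊤ := by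
  rw [← X.regular p hp.1 hp.2]
  congr 1
  ext v
  simp only [coe_image, coe_filter, mem_univ, true_and, Set.mem_image, Set.mem_ofPred_eq]
  exact exists_congr fun i => and_congr_right fun _ => eq_comm

theorem le_card_support {p : Fin (r + 3) → ℝ} (hp : p ∈ X.polyhedron) :
    r ≤ (univ.filter fun i => p i ≠ 0).card := by
  have h := finrank_span_finset_le_card (R := ℝ) ((univ.filter fun i => p i ≠ 0).image
      fun i => (fun a => (X.Q a i : ℝ)))
  rw [Set.finrank, span_support hp, finrank_top, Module.finrank_fin_fun] at h
  exact h.trans card_image_le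

/-- A point of the polyhedron supported on at most `r` indices is supported on exactly those. -/
theorem pos_of_support {p : Fin (r + 3) → ℝ} (hp : p ∈ X.polyhedron) {S : Finset (Fin (r + 3))}
    (hS : S.card ≤ r) (h : ∀ i, i ∉ S → p i = 0) {i : Fin (r + 3)} (hi : i ∈ S) : 0 < p i := by
  have hsub : (univ.filter fun i => p i ≠ 0) ⊆ S := fun i hi => by
    by_contra hiS
    exact (mem_filter.1 hi).2 (h i hiS)
  rw [← eq_of_subset_of_card_le hsub (hS.trans (le_card_support hp))] at hi
  exact lt_of_le_of_ne (hp.1 i) (mem_filter.1 hi).2.symm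

/-- By regularity the columns in the support span, and `r` spanning vectors of ℝ^r form a basis. -/
theorem det_ne_zero_of_support {p : Fin (r + 3) → ℝ} (hp : p ∈ X.polyhedron)
    {J : Fin r → Fin (r + 3)} (h : ∀ i, i ∉ Set.range J → p i = 0) : (X.Qsub J).det ≠ 0 := by
  have hspan : ⊤ ≤ Submodule.span ℝ (Set.range ((X.Qsub J).map (Int.cast : ℤ → ℝ)).col) := by
    rw [← span_support hp]
    refine Submodule.span_mono fun v hv => ?_
    simp only [coe_image, coe_filter, mem_univ, true_and, Set.mem_image, Set.mem_ofPred_eq] at hv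
    obtain ⟨i, hi, rfl⟩ := hv
    by_cases hiJ : i ∈ Set.range J
    · obtain ⟨k, rfl⟩ := hiJ
      exact ⟨k, rfl⟩
    · exact absurd (h i hiJ) hi
  have hli := linearIndependent_of_top_le_span_of_card_eq_finrank hspan (by simp)
  rw [Matrix.linearIndependent_cols_iff_isUnit, Matrix.isUnit_iff_isUnit_det, X.det_cast,
    isUnit_iff_ne_zero] at hli
  exact_mod_cast hli

/-- Coefficients of η in the cone of `J` are the coordinates of a point of the polyhedron supported
on `J`; regularity then makes the determinant condition automatic. -/
theorem mem_vertices {J : Fin r → Fin (r + 3)} :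
    J ∈ X.vertices ↔ StrictMono J ∧ ∃ p ∈ X.polyhedron, ∀ i, i ∉ Set.range J → p i = 0 := by
  classical
  simp only [vertices, mem_filter, mem_univ, true_and]
  refine and_congr_right fun hJ => ⟨fun ⟨_, c, hc, hη⟩ => ?_, fun ⟨p, hp, h⟩ => ?_⟩
  · refine ⟨∑ k, c k • Pi.single (J k) 1, ⟨fun j => ?_, fun a => ?_⟩, fun i hi => ?_⟩
    · simp only [Finset.sum_apply, Pi.smul_apply, smul_eq_mul]
      exact sum_nonneg fun k _ => mul_nonneg (hc k) (by
        by_cases h : j = J k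
        · subst h; simp
        · simp [h])
    · rw [← hη a]
      simp only [Finset.sum_apply, Pi.smul_apply, smul_eq_mul, mul_sum]
      rw [sum_comm]
      simp [Pi.single_apply, Qsub]
    · have : ∀ k, i ≠ J k := fun k h => hi ⟨k, h.symm⟩
      simp [this]
  · refine ⟨det_ne_zero_of_support hp h, fun k => p (J k), fun k => hp.1 _, fun a => ?_⟩
    rw [← hp.2 a]
    refine Fintype.sum_of_injective J hJ.injective _ _ (fun i hi => ?_) (fun k => rfl)
    rw [h i hi, mul_zero]

theorem det_ne_zero_of_mem_vertices {J : Fin r → Fin (r + 3)} (hJ : J ∈ X.vertices) :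
    (X.Qsub J).det ≠ 0 := by
  obtain ⟨_, p, hp, h⟩ := mem_vertices.1 hJ
  exact det_ne_zero_of_support hp h

theorem exists_vertex_coord {J : Fin r → Fin (r + 3)} (hJ : J ∈ X.vertices) :
    ∃ p ∈ X.polyhedron, (∀ i, i ∉ Set.range J → p i = 0) ∧ ∀ i ∈ Set.range J, 0 < p i := by
  classical
  obtain ⟨_, p, hp, h⟩ := mem_vertices.1 hJ
  refine ⟨p, hp, h, fun i hi => pos_of_support hp (S := univ.image J)
    (card_image_le.trans (by simp)) (fun i hi => h i fun ⟨k, hk⟩ => hi ?_) ?_⟩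
  · exact mem_image.2 ⟨k, mem_univ _, hk⟩
  · obtain ⟨k, rfl⟩ := hi
    exact mem_image_of_mem J (mem_univ k)

theorem mem_polyhedron_add {p v : Fin (r + 3) → ℝ} (hp : p ∈ X.polyhedron) (hv : X.IsRelation v)
    {s : ℝ} (h : ∀ i, 0 ≤ p i + s * v i) : (fun i => p i + s * v i) ∈ X.polyhedron := by
  refine ⟨h, fun a => ?_⟩
  have : ∑ j, (X.Q a j : ℝ) * (p j + s * v j)
      = ∑ j, (X.Q a j : ℝ) * p j + s * ∑ j, (X.Q a j : ℝ) * v j := by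
    rw [mul_sum, ← sum_add_distrib]
    exact sum_congr rfl fun _ _ => by ring
  rw [this, hp.2 a, hv a, mul_zero, add_zero]

/-- A compact divisor has no nonzero recession direction. -/
theorem relation_eq_zero_of_compact {I : Fin (r + 3)} (hI : I ∈ X.compactDivisors)
    {v : Fin (r + 3) → ℝ} (hv : X.IsRelation v) (h0 : ∀ i, 0 ≤ v i) (hvI : v I = 0) : v = 0 := by
  classical
  obtain ⟨⟨p, hp⟩, hc⟩ := (mem_filter.1 hI).2
  funext i
  by_contra hi
  have hpos : 0 < v i := lt_of_le_of_ne (h0 i) (Ne.symm hi)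
  obtain ⟨C, hC⟩ := (hc.image (continuous_apply i)).bddAbove
  have hmem : ∀ s : ℝ, 0 ≤ s → (fun i => p i + s * v i) ∈ X.divisorImage I := fun s hs => by
    have h := mem_polyhedron_add (X := X) ⟨hp.1, hp.2.1⟩ hv (s := s) fun i =>
      add_nonneg (hp.1 i) (mul_nonneg hs (h0 i))
    exact ⟨h.1, h.2, by simp [hp.2.2, hvI]⟩
  -- The parameter is chosen to push coordinate `i` to at least `|C| + 1`, past the bound `C`.
  have hle := hC ⟨_, hmem ((|C| + 1) / v i) (by positivity), rfl⟩
  simp only [div_mul_cancel₀ _ hpos.ne'] at hle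
  linarith [hp.1 i, le_abs_self C]

/-- The Calabi-Yau condition enters here: it supplies a strictly positive recession direction of the
polyhedron. -/
theorem isRelation_one : X.IsRelation (1 : Fin (r + 3) → ℝ) := fun a => by
  have := congrArg (fun y : ℤ => (y : ℝ)) (X.calabiYau a)
  simpa using this

theorem IsRelation.add_mul {v w : Fin (r + 3) → ℝ} (hv : X.IsRelation v) (hw : X.IsRelation w)
    (s : ℝ) : X.IsRelation fun i => v i + s * w i := fun a => by
  have : ∑ j, (X.Q a j : ℝ) * (v j + s * w j)
      = ∑ j, (X.Q a j : ℝ) * v j + s * ∑ j, (X.Q a j : ℝ) * w j := by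
    rw [mul_sum, ← sum_add_distrib]
    exact sum_congr rfl fun _ _ => by ring
  rw [this, hv a, hw a, mul_zero, add_zero]

/-- Going from a nonnegative vector in a direction with a negative coordinate, one reaches the
boundary of the orthant. -/
theorem exists_boundary {ι : Type*} [Fintype ι] {p v : ι → ℝ} (hp : ∀ i, 0 ≤ p i)
    {j : ι} (hj : v j < 0) :
    ∃ s, 0 ≤ s ∧ (∀ i, 0 ≤ p i + s * v i) ∧ ∃ i, v i < 0 ∧ p i + s * v i = 0 := by
  classical
  obtain ⟨i, hi, hmin⟩ := exists_min_image (univ.filter fun i => v i < 0) (fun i => p i / -v i)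
    ⟨j, mem_filter.2 ⟨mem_univ _, hj⟩⟩
  have hvi := (mem_filter.1 hi).2
  refine ⟨p i / -v i, div_nonneg (hp i) (by linarith), fun k => ?_, i, hvi, ?_⟩
  · by_cases hk : v k < 0
    · have := hmin k (mem_filter.2 ⟨mem_univ _, hk⟩)
      rw [le_div_iff₀ (by linarith)] at this
      linarith
    · exact add_nonneg (hp k) (mul_nonneg (div_nonneg (hp i) (by linarith)) (not_lt.1 hk))
  · rw [div_mul_eq_mul_div, div_neg, mul_div_cancel_right₀ _ hvi.ne, add_neg_cancel]

/-- A relation between the charge vectors of the compact divisors vanishes. -/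
theorem relation_eq_zero_of_support (hX : X.compactDivisors.Nonempty) {v : Fin (r + 3) → ℝ}
    (hv : X.IsRelation v) (h : ∀ i, i ∉ X.compactDivisors → v i = 0) : v = 0 := by
  -- the boundary point `1 + s v` of the recession cone lies over a compact divisor
  have key : ∀ v : Fin (r + 3) → ℝ, X.IsRelation v → (∀ i, i ∉ X.compactDivisors → v i = 0) →
      (∃ j, v j < 0) → ∃ s : ℝ, ∀ i, 1 + s * v i = 0 := by
    rintro v hv h ⟨j, hj⟩
    obtain ⟨s, -, hs, i, hi, hi0⟩ := exists_boundary (p := fun _ => (1 : ℝ)) (by simp) hj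
    have hI : i ∈ X.compactDivisors := by
      by_contra hI
      exact hi.ne (h i hI)
    have := relation_eq_zero_of_compact hI (isRelation_one.add_mul hv s) hs hi0
    exact ⟨s, fun i => congrFun this i⟩
  have key' : ∀ v : Fin (r + 3) → ℝ, X.IsRelation v → (∀ i, i ∉ X.compactDivisors → v i = 0) →
      ∃ c : ℝ, ∀ i, v i = c := by
    intro v hv h
    have aux : ∀ s : ℝ, (∀ i, 1 + s * v i = 0) → ∃ c : ℝ, ∀ i, v i = c := fun s hs => by
      have hs0 : s ≠ 0 := fun h0 => by simpa [h0] using hs 0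
      exact ⟨-1 / s, fun i => by field_simp; linarith [hs i]⟩
    by_cases h1 : ∃ j, v j < 0
    · obtain ⟨s, hs⟩ := key v hv h h1
      exact aux s hs
    · by_cases h2 : ∃ j, 0 < v j
      · obtain ⟨j, hj⟩ := h2
        obtain ⟨s, hs⟩ := key (fun i => 0 + -1 * v i)
          (IsRelation.add_mul (v := 0) (fun a => by simp) hv (-1)) (fun i hi => by simp [h i hi])
          ⟨j, by linarith⟩
        exact aux (-s) fun i => by linarith [hs i]
      · push Not at h1 h2
        exact ⟨0, fun i => le_antisymm (h2 i) (h1 i)⟩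
  by_contra hv0
  obtain ⟨c, hc⟩ := key' v hv h
  have hc0 : c ≠ 0 := fun h0 => hv0 (funext fun i => by rw [hc, h0]; rfl)
  have hall : ∀ i, i ∈ X.compactDivisors := fun i => by
    by_contra hi
    exact hc0 (by rw [← hc i, h i hi])
  -- all divisors are compact, but there is a nonconstant relation
  obtain ⟨I, hI⟩ := hX
  set A : Matrix (Fin r) (Fin (r + 3)) ℝ := X.Q.map (Int.cast : ℤ → ℝ) with hA
  have hdim : 1 < Module.finrank ℝ (LinearMap.ker A.mulVecLin) := by
    have h1 := LinearMap.finrank_range_add_finrank_ker A.mulVecLin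
    have h2 := Submodule.finrank_le (LinearMap.range A.mulVecLin)
    simp only [Module.finrank_fin_fun] at h1 h2
    omega
  -- With all divisors compact the support condition of `key'` is void, so every relation is
  -- constant; yet `r` equations in `r + 3` unknowns leave a kernel of dimension at least three.
  have hle : LinearMap.ker A.mulVecLin ≤ Submodule.span ℝ {(1 : Fin (r + 3) → ℝ)} := by
    intro w hw
    obtain ⟨c, hc⟩ := key' w (fun a => congrFun (LinearMap.mem_ker.1 hw) a)
      fun i hi => absurd (hall i) hi
    exact Submodule.mem_span_singleton.2 ⟨c, funext fun i => by simp [hc i]⟩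
  have := (Submodule.finrank_mono hle).trans (finrank_span_le_card _)
  simp at this
  omega

/-- The complex form of `relation_eq_zero_of_support`. -/
theorem complex_relation_eq_zero_of_support (hX : X.compactDivisors.Nonempty)
    {v : Fin (r + 3) → ℂ} (hv : X.IsRelation v) (h : ∀ i, i ∉ X.compactDivisors → v i = 0) :
    v = 0 := by
  have hre : X.IsRelation fun i => (v i).re := fun a => by
    have := congrArg Complex.re (hv a)
    simpa [Complex.re_sum, Complex.mul_re] using this
  have him : X.IsRelation fun i => (v i).im := fun a => by
    have := congrArg Complex.im (hv a)
    simpa [Complex.im_sum, Complex.mul_im] using this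
  have h1 := relation_eq_zero_of_support hX hre fun i hi => by simp [h i hi]
  have h2 := relation_eq_zero_of_support hX him fun i hi => by simp [h i hi]
  exact funext fun i => Complex.ext (congrFun h1 i) (congrFun h2 i)

/-! ### Edges of the moment polyhedron -/

/-- `J'` is obtained from `J` by exchanging `j'` for `j`. -/
def Exchange (J J' : Fin r → Fin (r + 3)) (j j' : Fin (r + 3)) : Prop :=
  j ∉ Set.range J ∧ j' ∈ Set.range J ∧ Set.range J' = insert j (Set.range J) \ {j'}

theorem Exchange.symm {J J' : Fin r → Fin (r + 3)} {j j' : Fin (r + 3)}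
    (h : Exchange J J' j j') : Exchange J' J j' j := by
  obtain ⟨h1, h2, h3⟩ := h
  have hne : j ≠ j' := fun h => h1 (h ▸ h2)
  refine ⟨by simp [h3], by rw [h3]; exact ⟨Or.inl rfl, hne⟩, ?_⟩
  rw [h3]
  ext i
  simp only [Set.mem_sdiff, Set.mem_insert_iff, Set.mem_singleton_iff]
  constructor
  · intro hi
    have : i ≠ j := fun h => h1 (h ▸ hi)
    tauto
  · rintro ⟨rfl | h, h'⟩
    · exact h2
    · tauto

theorem Exchange.insert_eq {J J' : Fin r → Fin (r + 3)} {j j' : Fin (r + 3)}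
    (h : Exchange J J' j j') : insert j' (Set.range J') = insert j (Set.range J) := by
  rw [h.2.2, Set.insert_sdiff_singleton, Set.insert_eq_of_mem (Set.mem_insert_of_mem _ h.2.1)]

/-- The relation along an edge takes a negative value at the exchanged index. -/
theorem Exchange.coord_eq {J J' : Fin r → Fin (r + 3)} {j j' : Fin (r + 3)}
    (h : Exchange J J' j j') (hJ : J ∈ X.vertices) {p p' : Fin (r + 3) → ℝ}
    (hp : p ∈ X.polyhedron) (hp' : p' ∈ X.polyhedron) (hp0 : ∀ i, i ∉ Set.range J → p i = 0)
    (hp0' : ∀ i, i ∉ Set.range J' → p' i = 0) {v : Fin (r + 3) → ℝ} (hv : X.IsRelation v)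
    (hvj : v j = 1) (hv0 : ∀ i, i ≠ j → i ∉ Set.range J → v i = 0) (i : Fin (r + 3)) :
    p' i = p i + p' j * v i := by
  -- This combination is a relation supported on the basis `J`, hence zero.
  have hrel : X.IsRelation fun i => p' i - p i - p' j * v i := fun a => by
    have : ∑ i, (X.Q a i : ℝ) * (p' i - p i - p' j * v i) = ∑ i, (X.Q a i : ℝ) * p' i
        - ∑ i, (X.Q a i : ℝ) * p i - p' j * ∑ i, (X.Q a i : ℝ) * v i := by
      rw [mul_sum, ← sum_sub_distrib, ← sum_sub_distrib]
      exact sum_congr rfl fun _ _ => by ring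
    rw [this, hp.2, hp'.2, hv a]
    ring
  have h0 := hrel.eq_zero (det_ne_zero_of_mem_vertices hJ) (mem_vertices.1 hJ).1.injective
    fun i hi => by
      by_cases hij : i = j
      · subst hij
        simp [hvj, hp0 i hi]
      · have hi' : i ∉ Set.range J' := by
          rw [h.2.2]
          rintro ⟨h1 | h1, -⟩
          exacts [hij h1, hi h1]
        simp [hp0 i hi, hp0' i hi', hv0 i hij hi]
  have := congrFun h0 i
  simp only [Pi.zero_apply] at this
  linarith

/-- From the first vertex to the second, coordinate `j` grows from zero while coordinate `j'` drops
from a positive value to zero; both changes are proportional to `v`. -/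
theorem Exchange.relation_neg {J J' : Fin r → Fin (r + 3)} {j j' : Fin (r + 3)}
    (h : Exchange J J' j j') (hJ : J ∈ X.vertices) (hJ' : J' ∈ X.vertices)
    {v : Fin (r + 3) → ℝ} (hv : X.IsRelation v)
    (hvj : v j = 1) (hv0 : ∀ i, i ≠ j → i ∉ Set.range J → v i = 0) : v j' < 0 := by
  obtain ⟨p, hp, hp0, hpos⟩ := exists_vertex_coord hJ
  obtain ⟨p', hp', hp0', hpos'⟩ := exists_vertex_coord hJ'
  have h1 := h.coord_eq hJ hp hp' hp0 hp0' hv hvj hv0 j'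
  rw [hp0' j' h.symm.1] at h1
  have h2 := hpos j' h.2.1
  have h3 := hpos' j h.symm.2.1
  by_contra hneg
  have := mul_nonneg h3.le (not_lt.1 hneg)
  linarith

/-- An edge has at most one other vertex. -/
theorem Exchange.unique {J J' J'' : Fin r → Fin (r + 3)} {j j' j'' : Fin (r + 3)}
    (h' : Exchange J J' j j') (h'' : Exchange J J'' j j'') (hJ : J ∈ X.vertices)
    (hJ' : J' ∈ X.vertices) (hJ'' : J'' ∈ X.vertices) : J' = J'' ∧ j' = j'' := by
  obtain ⟨v, hv, hvj, hv0⟩ := X.exists_isRelation (det_ne_zero_of_mem_vertices hJ) h'.1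
  obtain ⟨p, hp, hp0, -⟩ := exists_vertex_coord hJ
  obtain ⟨p', hp', hp0', hpos'⟩ := exists_vertex_coord hJ'
  obtain ⟨p'', hp'', hp0'', hpos''⟩ := exists_vertex_coord hJ''
  have e' := h'.coord_eq hJ hp hp' hp0 hp0' hv hvj hv0
  have e'' := h''.coord_eq hJ hp hp'' hp0 hp0'' hv hvj hv0
  have n' := h'.relation_neg hJ hJ' hv hvj hv0
  have n'' := h''.relation_neg hJ hJ'' hv hvj hv0
  have hjj : j' = j'' := by
    -- Both endpoints lie on the ray from `p` along `v`. If one lay farther out, its coordinate at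
    -- the index exchanged by the nearer one would be negative.
    have hs : p' j = p'' j := by
      have a1 := e' j'
      have a2 := e'' j''
      have a3 := e'' j'
      have a4 := e' j''
      rw [hp0' j' h'.symm.1] at a1
      rw [hp0'' j'' h''.symm.1] at a2
      have b3 := hp''.1 j'
      have b4 := hp'.1 j''
      nlinarith
    by_contra hne
    have hmem : j'' ∈ Set.range J' := by
      rw [h'.2.2]
      exact ⟨Or.inr h''.2.1, fun h => hne h.symm⟩
    have := hpos' j'' hmem
    rw [e', hs, ← e'', hp0'' j'' h''.symm.1] at this
    exact this.false
  subst hjj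
  exact ⟨(mem_vertices.1 hJ').1.range_inj (mem_vertices.1 hJ'').1 |>.1 (h'.2.2.trans h''.2.2.symm),
    rfl⟩

/-- An edge contained in a compact divisor has a second vertex. -/
theorem exists_exchange {J : Fin r → Fin (r + 3)} (hJ : J ∈ X.vertices) {j I : Fin (r + 3)}
    (hj : j ∉ Set.range J) (hI : I ∈ X.compactDivisors) (hIJ : I ∉ Set.range J) (hIj : I ≠ j) :
    ∃ J' ∈ X.vertices, ∃ j', Exchange J J' j j' := by
  classical
  obtain ⟨v, hv, hvj, hv0⟩ := X.exists_isRelation (det_ne_zero_of_mem_vertices hJ) hj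
  obtain ⟨p, hp, hp0, hpos⟩ := exists_vertex_coord hJ
  have hinj := (mem_vertices.1 hJ).1.injective
  -- A nonnegative `v` would be a recession direction of the compact divisor `I`, on which it
  -- vanishes.
  obtain ⟨l, hl⟩ : ∃ l, v l < 0 := by
    by_contra hcon
    push Not at hcon
    have := relation_eq_zero_of_compact hI hv hcon (hv0 I hIj hIJ)
    rw [this] at hvj
    simp at hvj
  -- The second vertex is where the edge leaves the orthant; `j'` is a coordinate that vanishes
  -- there.
  obtain ⟨s, hs, hs0, j', hj', hj'0⟩ := exists_boundary hp.1 hl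
  have hj'J : j' ∈ Set.range J := by
    by_contra hcon
    have : j' ≠ j := fun h => by rw [h, hvj] at hj'; linarith
    exact hj'.ne (hv0 j' this hcon)
  have hjj' : j ≠ j' := fun h => hj (h ▸ hj'J)
  set S : Finset (Fin (r + 3)) := insert j ((univ.image J).erase j') with hS
  have hcard : S.card = r := by
    obtain ⟨k, rfl⟩ := hj'J
    rw [hS, card_insert_of_notMem, card_erase_of_mem (mem_image_of_mem J (mem_univ k)),
      card_image_of_injective _ hinj, card_univ, Fintype.card_fin]
    · have := k.pos
      omega
    · intro h
      obtain ⟨k', -, h'⟩ := mem_image.1 (mem_erase.1 h).2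
      exact hj ⟨k', h'⟩
  have hrange : Set.range (S.orderEmbOfFin hcard) = insert j (Set.range J) \ {j'} := by
    rw [range_orderEmbOfFin]
    ext i
    simp only [hS, coe_insert, coe_erase, coe_image, coe_univ, Set.image_univ, Set.mem_insert_iff,
      Set.mem_sdiff, Set.mem_singleton_iff]
    constructor
    · rintro (rfl | h)
      exacts [⟨Or.inl rfl, hjj'⟩, ⟨Or.inr h.1, h.2⟩]
    · tauto
  refine ⟨S.orderEmbOfFin hcard, mem_vertices.2 ⟨(S.orderEmbOfFin hcard).strictMono, _,
    mem_polyhedron_add hp hv hs0, fun i hi => ?_⟩, j', hj, hj'J, hrange⟩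
  rw [hrange] at hi
  by_cases hij' : i = j'
  · rw [hij', hj'0]
  · have h1 : i ≠ j := fun h => hi ⟨Or.inl h, hij'⟩
    have h2 : i ∉ Set.range J := fun h => hi ⟨Or.inr h, hij'⟩
    rw [hp0 i h2, hv0 i h1 h2]
    ring

end ToricCY3

/-! ### Means over the unit circle -/

/-- The mean of a continuous function on the unit circle. -/
noncomputable def circleMean : C(Circle, ℂ) →L[ℂ] ℂ :=
  LinearMap.mkContinuous
    { toFun := fun f => (2 * Real.pi : ℂ)⁻¹ * ∫ θ in (0 : ℝ)..2 * Real.pi, f (Circle.exp θ)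
      map_add' := fun f g => by
        have hf : Continuous fun θ : ℝ => f (Circle.exp θ) := by fun_prop
        have hg : Continuous fun θ : ℝ => g (Circle.exp θ) := by fun_prop
        simp only [ContinuousMap.add_apply]
        rw [intervalIntegral.integral_add (hf.intervalIntegrable _ _)
          (hg.intervalIntegrable _ _), mul_add]
      map_smul' := fun c f => by
        simp only [ContinuousMap.smul_apply, smul_eq_mul, RingHom.id_apply,
          intervalIntegral.integral_const_mul]
        ring } 1 fun f => by
    have h : ‖∫ θ in (0 : ℝ)..2 * Real.pi, f (Circle.exp θ)‖ ≤ ‖f‖ * |2 * Real.pi - 0| :=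
      intervalIntegral.norm_integral_le_of_norm_le_const fun θ _ => f.norm_coe_le_norm _
    have hpi := Real.pi_pos
    rw [sub_zero, abs_of_pos (by positivity)] at h
    simp only [LinearMap.coe_mk, AddHom.coe_mk, norm_mul, norm_inv, Complex.norm_ofNat,
      Complex.norm_real, Real.norm_eq_abs, abs_of_pos hpi, one_mul]
    rw [inv_mul_le_iff₀ (by positivity)]
    linarith

/-- The measure dθ/2π is dz/(2πi z): the mean acquires an extra pole at z = 0, whose residue is the
value at the centre. -/
theorem circleMean_eq {F : C(Circle, ℂ)} {f : ℂ → ℂ} (h : ∀ z : Circle, F z = f z) :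
    circleMean F = (2 * Real.pi * Complex.I)⁻¹ * ∮ z in C(0, 1), z⁻¹ * f z := by
  have h1 := Real.circleAverage_eq_circleIntegral (f := f) (c := 0) one_ne_zero
  simp only [sub_zero, smul_eq_mul] at h1
  rw [← h1, Real.circleAverage]
  simp only [circleMean, LinearMap.mkContinuous_apply, LinearMap.coe_mk, AddHom.coe_mk, h,
    Circle.coe_exp, circleMap, Complex.ofReal_one, one_mul, zero_add, Complex.real_smul]
  push_cast
  rfl

/-- Cauchy's formula for derivatives extracts the Taylor coefficient of order `k` of the
exponential. The powers of linear forms in the shift polynomials originate here. -/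
theorem circleMean_exp_div_pow {F : C(Circle, ℂ)} {u : ℂ} {k : ℕ}
    (h : ∀ z : Circle, F z = Complex.exp (u * z) / (z : ℂ) ^ k) :
    circleMean F = u ^ k / k.factorial := by
  have hd : DifferentiableOn ℂ (fun z => Complex.exp (u * z)) (Metric.closedBall 0 1) := by
    fun_prop
  have hc := hd.circleIntegral_one_div_sub_center_pow_smul one_pos k
  rw [iteratedDeriv_cexp_const_mul] at hc
  rw [circleMean_eq (f := fun z => Complex.exp (u * z) / z ^ k) h]
  have : ∀ z : ℂ, z⁻¹ * (Complex.exp (u * z) / z ^ k)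
      = (1 / (z - 0) ^ (k + 1)) • Complex.exp (u * z) := fun z => by
    rw [sub_zero, smul_eq_mul, pow_succ, one_div, mul_inv]
    ring
  simp only [this, hc]
  have := Complex.two_pi_I_ne_zero
  simp only [mul_zero, Complex.exp_zero, mul_one, smul_eq_mul]
  field_simp

/-- Partial fractions, obtained by Lagrange interpolation of the constant 1 at the nodes. -/
theorem inv_prod_sub_eq_sum {ι : Type*} [DecidableEq ι] {s : Finset ι} (hs : s.Nonempty)
    {a : ι → ℂ} (ha : Set.InjOn a s) {z : ℂ} (hz : ∀ i ∈ s, z ≠ a i) :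
    (∏ i ∈ s, (z - a i))⁻¹ = ∑ i ∈ s, (∏ l ∈ s.erase i, (a i - a l))⁻¹ * (z - a i)⁻¹ := by
  have h := Lagrange.eval_interpolate_not_at_node (s := s) (v := a) (x := z) 1 hz
  rw [Lagrange.interpolate_one ha hs, Polynomial.eval_one, Lagrange.eval_nodal] at h
  rw [inv_eq_of_mul_eq_one_right h.symm]
  exact Finset.sum_congr rfl fun i _ => by
    rw [Lagrange.nodalWeight, Finset.prod_inv_distrib, Pi.one_apply, mul_one]

/-- The mean of `f / ∏ (z - a_i)` over the unit circle: sum over the residues at `0` and at the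
points `a_i` inside the circle. -/
theorem circleMean_div_prod {ι : Type*} [DecidableEq ι] {F : C(Circle, ℂ)} {f : ℂ → ℂ}
    (hf : Differentiable ℂ f) {s : Finset ι} {a : ι → ℂ} (ha : Set.InjOn a s)
    (ha0 : ∀ i ∈ s, a i ≠ 0) (ha1 : ∀ i ∈ s, ‖a i‖ < 1)
    (h : ∀ z : Circle, F z = f z / ∏ i ∈ s, (z - a i)) :
    circleMean F = f 0 / ∏ i ∈ s, (0 - a i)
      + ∑ i ∈ s, f (a i) / (a i * ∏ l ∈ s.erase i, (a i - a l)) := by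
  -- The node `none` is the pole at 0 that comes from dz/z.
  set b : Option ι → ℂ := fun o => o.elim 0 a with hb
  set S : Finset (Option ι) := Finset.insertNone s with hS
  have hbS : Set.InjOn b S := by
    rintro (_ | i) hi (_ | l) hl hil
    · rfl
    · exact absurd hil.symm (ha0 l (by simpa [hS] using hl))
    · exact absurd hil (ha0 i (by simpa [hS] using hi))
    · rw [ha (by simpa [hS] using hi) (by simpa [hS] using hl) hil]
  have hb1 : ∀ o ∈ S, ‖b o‖ < 1 := by
    rintro (_ | i) hi
    · simp [hb]
    · exact ha1 i (by simpa [hS] using hi)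
  have hSne : S.Nonempty := ⟨none, by simp [hS]⟩
  have hsphere : ∀ z ∈ Metric.sphere (0 : ℂ) 1, ∀ o ∈ S, z ≠ b o := fun z hz o ho hzo => by
    have := hb1 o ho
    rw [← hzo, mem_sphere_zero_iff_norm.1 hz] at this
    exact this.false
  have hcauchy : ∀ o ∈ S, ∮ z in C(0, 1), (z - b o)⁻¹ • f z = (2 * Real.pi * Complex.I) • f (b o) :=
    fun o ho => hf.differentiableOn.circleIntegral_sub_inv_smul (by simpa using hb1 o ho)
  have hint : ∮ z in C(0, 1), z⁻¹ * (f z / ∏ i ∈ s, (z - a i))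
      = ∮ z in C(0, 1), ∑ o ∈ S,
        (∏ l ∈ S.erase o, (b o - b l))⁻¹ • ((z - b o)⁻¹ • f z) := by
    refine circleIntegral.integral_congr zero_le_one fun z hz => ?_
    have h1 := inv_prod_sub_eq_sum hSne hbS (hsphere z hz)
    rw [hS, Finset.prod_insertNone, ← hS] at h1
    simp only [show b none = 0 from rfl, show ∀ i, b (some i) = a i from fun _ => rfl,
      sub_zero] at h1
    simp only [smul_eq_mul, ← mul_assoc]
    rw [← Finset.sum_mul, ← h1, mul_inv]
    ring
  have hpi := Complex.two_pi_I_ne_zero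
  rw [circleMean_eq (f := fun z => f z / ∏ i ∈ s, (z - a i)) h, hint,
    circleIntegral.integral_fun_sum]
  · simp only [circleIntegral.integral_smul]
    rw [Finset.sum_congr rfl fun o ho => by rw [hcauchy o ho]]
    rw [hS, Finset.sum_insertNone, ← hS, mul_add, Finset.mul_sum]
    have e1 : S.erase none = s.map Function.Embedding.some := by
      ext (_ | i) <;> simp [hS]
    congr 1
    · rw [e1, Finset.prod_map]
      simp only [hb, Option.elim, smul_eq_mul, Function.Embedding.some_apply]
      field_simp
    · refine Finset.sum_congr rfl fun i hi => ?_
      have e2 : S.erase (some i) = Finset.insertNone (s.erase i) := by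
        ext (_ | l) <;> simp [hS]
      rw [e2, Finset.prod_insertNone]
      simp only [hb, Option.elim, smul_eq_mul, sub_zero]
      field_simp
  · intro o ho
    have h1 : ContinuousOn (fun z => (z - b o)⁻¹) (Metric.sphere (0 : ℂ) 1) :=
      (continuousOn_id.sub continuousOn_const).inv₀
        fun z hz => sub_ne_zero.2 (hsphere z hz o ho)
    have h2 : ContinuousOn (fun z => (∏ l ∈ S.erase o, (b o - b l))⁻¹ • ((z - b o)⁻¹ • f z))
        (Metric.sphere (0 : ℂ) 1) :=
      continuousOn_const.mul (h1.mul hf.continuous.continuousOn)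
    exact h2.circleIntegrable zero_le_one

namespace ToricCY3

open Finset

variable {r : ℕ} {X : ToricCY3 r}

/-! ### Cancellation of residues along compact edges -/

/-- One relation `v` computes both weights: the pairing of `v` with ε is the weight of `j` at `J`,
and also `v j'` times the weight of `j'` at `J'`. The determinants differ by |v j'|, and `v j'` is
negative. This sign makes residues cancel. -/
theorem Exchange.weight_eq {J J' : Fin r → Fin (r + 3)} {j j' : Fin (r + 3)}
    (h : Exchange J J' j j') (hJ : J ∈ X.vertices) (hJ' : J' ∈ X.vertices)
    (ε : Fin (r + 3) → ℂ) :
    ((|(X.Qsub J').det| : ℤ) : ℂ) * X.weight J' j' ε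
      = -(((|(X.Qsub J).det| : ℤ) : ℂ) * X.weight J j ε) := by
  have hd := det_ne_zero_of_mem_vertices hJ
  have hd' := det_ne_zero_of_mem_vertices hJ'
  obtain ⟨v, hv, hvj, hv0⟩ := X.exists_isRelation hd h.1
  have hneg := h.relation_neg hJ hJ' hv hvj hv0
  have hdet := X.abs_det_exchange (mem_vertices.1 hJ).1.injective
    (mem_vertices.1 hJ').1.injective hv h.1 h.2.1 h.2.2 hvj hv0
  rw [abs_of_neg hneg] at hdet
  have hdetC : ((|(X.Qsub J').det| : ℤ) : ℂ) = -v j' * ((|(X.Qsub J).det| : ℤ) : ℂ) := by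
    have : ((|(X.Qsub J').det| : ℤ) : ℝ) = -v j' * ((|(X.Qsub J).det| : ℤ) : ℝ) := by
      exact_mod_cast hdet
    have := congrArg Complex.ofReal this
    rwa [Complex.ofReal_mul, Complex.ofReal_neg, Complex.ofReal_intCast,
      Complex.ofReal_intCast] at this
  have h1 := hv.ofReal.mul_weight hd (j := j)
    (fun i hij hi => by simp [hv0 i hij hi]) ε
  have h2 := hv.ofReal.mul_weight hd' (j := j') (fun i hij hi => by
    have hi' : i ∉ insert j (Set.range J) := by
      rw [← h.insert_eq]
      rintro (h1 | h1)
      exacts [hij h1, hi h1]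
    simp [hv0 i (fun h => hi' (Or.inl h)) (fun h => hi' (Or.inr h))]) ε
  rw [hvj, Complex.ofReal_one, one_mul, ← h2] at h1
  rw [hdetC, h1]
  ring

/-- Where this weight vanishes, the pole of `J` also lies on x_j = 0, so it solves all the equations
defining the pole of `J'`. -/
theorem Exchange.pole_eq {J J' : Fin r → Fin (r + 3)} {j j' : Fin (r + 3)}
    (h : Exchange J J' j j') (hJ : (X.Qsub J).det ≠ 0) (hJ' : (X.Qsub J').det ≠ 0)
    {ε : Fin (r + 3) → ℂ} (h0 : X.weight J j ε = 0) : X.pole J ε = X.pole J' ε := by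
  refine X.eq_pole hJ' fun k => ?_
  have : J' k ∈ insert j (Set.range J) := by
    rw [← h.insert_eq]
    exact Or.inr ⟨k, rfl⟩
  rcases this with hk | ⟨l, hl⟩
  · rw [hk, ← weight_apply, h0]
  · rw [← hl, X.x_pole_mem hJ]

open Classical in
/-- The indices outside of `J`. -/
noncomputable def co (J : Fin r → Fin (r + 3)) : Finset (Fin (r + 3)) :=
  univ.filter fun i => i ∉ Set.range J

theorem mem_co {J : Fin r → Fin (r + 3)} {i : Fin (r + 3)} : i ∈ co J ↔ i ∉ Set.range J := by
  simp [co]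

theorem Exchange.co_erase {J J' : Fin r → Fin (r + 3)} {j j' : Fin (r + 3)}
    (h : Exchange J J' j j') : (co J').erase j' = (co J).erase j := by
  ext i
  have := Set.ext_iff.1 h.insert_eq i
  simp only [Set.mem_insert_iff] at this
  simp only [mem_erase, mem_co]
  tauto

/-- This is the dimension of the threefold; it fixes the total degree of the shift polynomials. -/
theorem card_co {J : Fin r → Fin (r + 3)} (hJ : Function.Injective J) : (co J).card = 3 := by
  classical
  have : co J = (univ.image J)ᶜ := by
    ext i
    simp [mem_co]
  rw [this, card_compl, card_image_of_injective _ hJ]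
  simp

/-- Sums of functions which are odd under a partial matching vanish. -/
theorem sum_eq_zero_of_matching {ι : Type*} {s : Finset ι} {f : ι → ℂ} (M : ι → ι → Prop)
    (hsymm : ∀ a b, M a b → M b a) (hirr : ∀ a, ¬M a a)
    (huniq : ∀ a ∈ s, ∀ b ∈ s, ∀ c ∈ s, M a b → M a c → b = c)
    (hf : ∀ a ∈ s, ∀ b ∈ s, M a b → f a + f b = 0)
    (h0 : ∀ a ∈ s, (∀ b ∈ s, ¬M a b) → f a = 0) : ∑ a ∈ s, f a = 0 := by
  classical
  -- An unmatched element is its own partner, which is harmless because `f` vanishes on it.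
  let g : ∀ a ∈ s, ι := fun a _ => if h : ∃ b ∈ s, M a b then h.choose else a
  have hg : ∀ a ha, (∃ b ∈ s, M a b) → g a ha ∈ s ∧ M a (g a ha) := fun a ha h => by
    simp only [g, dif_pos h]
    exact h.choose_spec
  have hg' : ∀ a ha, (¬∃ b ∈ s, M a b) → g a ha = a := fun a ha h => by
    simp only [g, dif_neg h]
  have hmem : ∀ a ha, g a ha ∈ s := fun a ha => by
    by_cases h : ∃ b ∈ s, M a b
    · exact (hg a ha h).1
    · rw [hg' a ha h]; exact ha
  refine sum_involution g (fun a ha => ?_) (fun a ha hfa => ?_) hmem (fun a ha => ?_)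
  · by_cases h : ∃ b ∈ s, M a b
    · exact hf a ha _ (hg a ha h).1 (hg a ha h).2
    · have := h0 a ha fun b hb hM => h ⟨b, hb, hM⟩
      rw [hg' a ha h, this, add_zero]
  · by_cases h : ∃ b ∈ s, M a b
    · intro heq
      have := (hg a ha h).2
      rw [heq] at this
      exact hirr a this
    · exact absurd (h0 a ha fun b hb hM => h ⟨b, hb, hM⟩) hfa
  · by_cases h : ∃ b ∈ s, M a b
    · have h1 := hg a ha h
      have h2 := hg (g a ha) (hmem a ha) ⟨a, ha, hsymm _ _ h1.2⟩
      exact huniq _ h1.1 _ h2.1 _ ha h2.2 (hsymm _ _ h1.2)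
    · have h1 := hg' a ha h
      simp only [h1]

end ToricCY3

/-! ### Scaling of homogeneous polynomials. -/

theorem MvPolynomial.IsHomogeneous.eval_const_mul {σ R : Type*} [CommSemiring R]
    {p : MvPolynomial σ R} {n : ℕ} (hp : p.IsHomogeneous n) (c : R) (f : σ → R) :
    MvPolynomial.eval (fun i => c * f i) p = c ^ n * MvPolynomial.eval f p := by
  rw [MvPolynomial.eval_eq, MvPolynomial.eval_eq, Finset.mul_sum]
  refine Finset.sum_congr rfl fun d hd => ?_
  have h := hp (MvPolynomial.mem_support_iff.1 hd)
  rw [Finsupp.weight_apply, Finsupp.sum] at h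
  simp only [Pi.one_apply, smul_eq_mul, mul_one] at h
  simp only [mul_pow, Finset.prod_mul_distrib, Finset.prod_pow_eq_pow_sum, h]
  ring

namespace ToricCY3

open Finset

variable {r : ℕ} {X : ToricCY3 r}

/-! ### Generic equivariant parameters -/

variable (X) in
/-- The equivariant parameters that vanish along the compact divisors. -/
def parameters : Submodule ℂ (Fin (r + 3) → ℂ) where
  carrier := {ε | ∀ I ∈ X.compactDivisors, ε I = 0}
  add_mem' := fun {a b} ha hb I hI => by simp [ha I hI, hb I hI]
  zero_mem' := fun _ _ => rfl
  smul_mem' := fun c a ha I hI => by simp [ha I hI]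

theorem admissible_iff {ε : Fin (r + 3) → ℂ} : X.Admissible ε ↔
    ε ∈ X.parameters ∧ ∀ J ∈ X.vertices, ∀ i ∈ co J, X.weight J i ε ≠ 0 := by
  simp only [Admissible, mem_co, weight_apply]
  rfl

/-- The parameter space contains every coordinate vector of a noncompact index, so a relation
orthogonal to it is supported on the compact divisors. -/
theorem exists_sum_ne_zero (hX : X.compactDivisors.Nonempty) {v : Fin (r + 3) → ℂ}
    (hv : X.IsRelation v) (hv0 : v ≠ 0) : ∃ e ∈ X.parameters, ∑ i, v i * e i ≠ 0 := by
  by_contra hcon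
  push Not at hcon
  refine hv0 (complex_relation_eq_zero_of_support hX hv fun i hi => ?_)
  have := hcon (Pi.single i 1) fun I hI => by
    rw [Pi.single_eq_of_ne]
    rintro rfl
    exact hi hI
  simpa [Pi.single_apply] using this

/-- Each weight is the pairing with a nonzero relation, hence a nonzero functional on the
parameters. Finitely many such functionals have a common point of nonvanishing. -/
theorem exists_admissible (hX : X.compactDivisors.Nonempty) : ∃ d, X.Admissible d := by
  obtain ⟨d, hd, h⟩ := Module.Dual.exists_forall_mem_ne_zero_of_forall_exists X.parameters
    (ι := {a : (Fin r → Fin (r + 3)) × Fin (r + 3) // a.1 ∈ X.vertices ∧ a.2 ∈ co a.1})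
    (f := fun a => X.weight a.1.1 a.1.2) (fun ⟨⟨J, i⟩, hJ, hi⟩ => by
      have hd := det_ne_zero_of_mem_vertices hJ
      obtain ⟨v, hv, hvi, hv0⟩ := X.exists_isRelation hd (mem_co.1 hi)
      obtain ⟨e, he, hne⟩ := exists_sum_ne_zero hX hv.ofReal fun h => by
        simpa [hvi] using congrFun h i
      rw [← hv.ofReal.mul_weight hd (j := i) (fun l hl hlJ => by simp [hv0 l hl hlJ])] at hne
      exact ⟨e, he, right_ne_zero_of_mul hne⟩)
  exact ⟨d, admissible_iff.2 ⟨hd, fun J hJ i hi => h ⟨⟨J, i⟩, hJ, hi⟩⟩⟩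

/-- A direction along which the weights at each vertex are pairwise independent of those of `d`. -/
theorem exists_generic (hX : X.compactDivisors.Nonempty) {d : Fin (r + 3) → ℂ}
    (hd : X.Admissible d) : ∃ e ∈ X.parameters, ∀ J ∈ X.vertices, ∀ i ∈ co J, ∀ l ∈ co J, i ≠ l →
      X.weight J i e * X.weight J l d - X.weight J l e * X.weight J i d ≠ 0 := by
  obtain ⟨e, he, h⟩ := Module.Dual.exists_forall_mem_ne_zero_of_forall_exists X.parameters
    (ι := {a : (Fin r → Fin (r + 3)) × Fin (r + 3) × Fin (r + 3) //
      a.1 ∈ X.vertices ∧ a.2.1 ∈ co a.1 ∧ a.2.2 ∈ co a.1 ∧ a.2.1 ≠ a.2.2})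
    (f := fun a => X.weight a.1.1 a.1.2.2 d • X.weight a.1.1 a.1.2.1
      - X.weight a.1.1 a.1.2.1 d • X.weight a.1.1 a.1.2.2) (fun ⟨⟨J, i, l⟩, hJ, hi, hl, hil⟩ => by
      have hdet := det_ne_zero_of_mem_vertices hJ
      dsimp only at hJ hi hl hil ⊢
      obtain ⟨v, hv, hvi, hv0⟩ := X.exists_isRelation hdet (mem_co.1 hi)
      obtain ⟨w, hw, hwl, hw0⟩ := X.exists_isRelation hdet (mem_co.1 hl)
      have hwi : w i = 0 := hw0 i hil (mem_co.1 hi)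
      have e1 := hv.ofReal.mul_weight hdet (j := i) (fun l hl hlJ => by simp [hv0 l hl hlJ])
      have e2 := hw.ofReal.mul_weight hdet (j := l) (fun l hl hlJ => by simp [hw0 l hl hlJ])
      simp only [hvi, hwl, Complex.ofReal_one, one_mul] at e1 e2
      -- The functional is the pairing with this combined relation, whose coordinate `i` is the
      -- nonzero weight of `l` at `d`.
      obtain ⟨e, he, hne⟩ := exists_sum_ne_zero hX
        (v := fun k => X.weight J l d * v k - X.weight J i d * w k) (fun a => by
          have h1 := hv.ofReal a
          have h2 := hw.ofReal a
          simp only [mul_sub, sum_sub_distrib]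
          have : ∀ (c : ℂ) (u : Fin (r + 3) → ℂ), ∑ k, (X.Q a k : ℂ) * (c * u k)
              = c * ∑ k, (X.Q a k : ℂ) * u k := fun c u => by
            rw [mul_sum]
            exact sum_congr rfl fun _ _ => by ring
          rw [this, this, h1, h2]
          ring) fun h => by
            have := congrFun h i
            simp only [hvi, hwi, Complex.ofReal_one, Complex.ofReal_zero, mul_one, mul_zero,
              sub_zero, Pi.zero_apply] at this
            exact (admissible_iff.1 hd).2 J hJ l hl this
      refine ⟨e, he, ?_⟩
      have : ∀ (c c' : ℂ) (u u' : Fin (r + 3) → ℂ), ∑ k, (c * u k - c' * u' k) * e k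
          = c * ∑ k, u k * e k - c' * ∑ k, u' k * e k := fun c c' u u' => by
        rw [mul_sum, mul_sum, ← sum_sub_distrib]
        exact sum_congr rfl fun _ _ => by ring
      rw [this, ← e1, ← e2] at hne
      simpa using hne)
  refine ⟨e, he, fun J hJ i hi l hl hil => ?_⟩
  have := h ⟨⟨J, i, l⟩, hJ, hi, hl, hil⟩
  simp only [LinearMap.sub_apply, LinearMap.smul_apply, smul_eq_mul] at this
  rwa [mul_comm, mul_comm (X.weight J l e)]

theorem Admissible.smul {d : Fin (r + 3) → ℂ} (hd : X.Admissible d) {s : ℂ} (hs : s ≠ 0) :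
    X.Admissible (s • d) := by
  rw [admissible_iff] at hd ⊢
  refine ⟨X.parameters.smul_mem s hd.1, fun J hJ i hi => ?_⟩
  rw [map_smul, smul_eq_mul]
  exact mul_ne_zero hs (hd.2 J hJ i hi)

/-! ### The residue theorem on a line of equivariant parameters -/

/-- The numerator of the difference of two Jeffrey-Kirwan integrands. -/
noncomputable def numerator (X : ToricCY3 r) (p : MvPolynomial (Fin (r + 3)) ℂ)
    (t t' : Fin r → ℂ) (ε : Fin (r + 3) → ℂ) (φ : Fin r → ℂ) : ℂ :=
  (Complex.exp (∑ a, t a * φ a) - Complex.exp (∑ a, t' a * φ a))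
    * MvPolynomial.eval (X.x ε φ) p

/-- The residue at the point `x_i = 0` of the line `ε + z d`. -/
noncomputable def lineResidue (X : ToricCY3 r) (f : (Fin (r + 3) → ℂ) → (Fin r → ℂ) → ℂ)
    (ε d : Fin (r + 3) → ℂ) (J : Fin r → Fin (r + 3)) (i : Fin (r + 3)) : ℂ :=
  let a := -X.weight J i ε / X.weight J i d
  f (ε + a • d) (X.pole J (ε + a • d)) / (((|(X.Qsub J).det| : ℤ) : ℂ) * X.weight J i d
    * (a * ∏ l ∈ (co J).erase i, X.weight J l (ε + a • d)))

theorem jkIntegral_eq (ε : Fin (r + 3) → ℂ) (f : (Fin r → ℂ) → ℂ) : X.jkIntegral ε f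
    = ∑ J ∈ X.vertices, f (X.pole J ε) /
      (((|(X.Qsub J).det| : ℤ) : ℂ) * ∏ i ∈ co J, X.weight J i ε) := by
  simp only [jkIntegral, co, weight_apply]

/-- Along the line each weight is its value at `d` times z - a_i. The hypotheses make the roots a_i
nonzero, of modulus below one and distinct, so all poles are simple. -/
theorem circleMean_vertex {f : (Fin (r + 3) → ℂ) → (Fin r → ℂ) → ℂ} {ε d : Fin (r + 3) → ℂ}
    {J : Fin r → Fin (r + 3)}
    (hf : Differentiable ℂ fun z : ℂ => f (ε + z • d) (X.pole J (ε + z • d)))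
    (hε : ∀ i ∈ co J, X.weight J i ε ≠ 0)
    (hlt : ∀ i ∈ co J, ‖X.weight J i ε‖ < ‖X.weight J i d‖)
    (hgen : ∀ i ∈ co J, ∀ l ∈ co J, i ≠ l →
      X.weight J i ε * X.weight J l d - X.weight J l ε * X.weight J i d ≠ 0)
    {F : C(Circle, ℂ)} (hF : ∀ z : Circle, F z = f (ε + (z : ℂ) • d) (X.pole J (ε + (z : ℂ) • d)) /
      (((|(X.Qsub J).det| : ℤ) : ℂ) * ∏ i ∈ co J, X.weight J i (ε + (z : ℂ) • d))) :
    circleMean F = f ε (X.pole J ε) / (((|(X.Qsub J).det| : ℤ) : ℂ) * ∏ i ∈ co J, X.weight J i ε)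
      + ∑ i ∈ co J, X.lineResidue f ε d J i := by
  set D : ℂ := ((|(X.Qsub J).det| : ℤ) : ℂ) with hD
  have hd : ∀ i ∈ co J, X.weight J i d ≠ 0 := fun i hi => norm_pos_iff.1
    ((norm_nonneg _).trans_lt (hlt i hi))
  set a : Fin (r + 3) → ℂ := fun i => -X.weight J i ε / X.weight J i d with ha
  have hlin : ∀ i ∈ co J, ∀ z : ℂ, X.weight J i (ε + z • d) = X.weight J i d * (z - a i) :=
    fun i hi z => by
      have := hd i hi
      rw [map_add, map_smul, smul_eq_mul, ha]
      field_simp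
      ring
  have hinj : Set.InjOn a (co J) := fun i hi l hl hil => by
    by_contra hne
    have h1 := hd i hi
    have h2 := hd l hl
    refine hgen i hi l hl hne ?_
    simp only [ha] at hil
    field_simp at hil
    linear_combination -hil
  have hprod : ∀ z : ℂ, ∏ i ∈ co J, X.weight J i (ε + z • d)
      = (∏ i ∈ co J, X.weight J i d) * ∏ i ∈ co J, (z - a i) := fun z => by
    rw [← prod_mul_distrib]
    exact prod_congr rfl fun i hi => hlin i hi z
  rw [circleMean_div_prod (f := fun z => f (ε + z • d) (X.pole J (ε + z • d))
    / (D * ∏ i ∈ co J, X.weight J i d)) (hf.div_const _) hinj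
    (fun i hi => div_ne_zero (neg_ne_zero.2 (hε i hi)) (hd i hi))
    (fun i hi => by
      rw [ha, norm_div, norm_neg, div_lt_one ((norm_nonneg _).trans_lt (hlt i hi))]
      exact hlt i hi)
    (fun z => by rw [hF z, hprod, div_div, mul_assoc])]
  congr 1
  · have := hprod 0
    rw [zero_smul, add_zero] at this
    rw [zero_smul, add_zero, div_div, this, mul_assoc]
  · refine sum_congr rfl fun i hi => ?_
    rw [lineResidue, div_div]
    congr 1
    rw [prod_congr rfl fun l hl => hlin l (mem_erase.1 hl).2 (a i), prod_mul_distrib,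
      ← mul_prod_erase (co J) (fun i => X.weight J i d) hi]
    ring

/-- Pairs (vertex, outgoing edge) are matched by exchanging the two ends of the edge. Both ends have
the same root and the same pole there, and opposite prefactors. -/
theorem sum_lineResidue_eq_zero {f : (Fin (r + 3) → ℂ) → (Fin r → ℂ) → ℂ}
    (hf : ∀ ε ∈ X.parameters, ∀ φ, (∀ I ∈ X.compactDivisors, X.x ε φ I = 0) → f ε φ = 0)
    {ε d : Fin (r + 3) → ℂ} (hε : ε ∈ X.parameters) (hd : X.Admissible d) :
    ∑ J ∈ X.vertices, ∑ i ∈ co J, X.lineResidue f ε d J i = 0 := by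
  rw [admissible_iff] at hd
  rw [sum_sigma']
  have hroot : ∀ J ∈ X.vertices, ∀ j ∈ co J,
      X.weight J j (ε + (-X.weight J j ε / X.weight J j d) • d) = 0 := fun J hJ j hj => by
    have := hd.2 J hJ j hj
    rw [map_add, map_smul, smul_eq_mul]
    field_simp
    ring
  refine sum_eq_zero_of_matching (fun a b => Exchange a.1 b.1 a.2 b.2) (fun a b h => h.symm)
    (fun a h => h.1 h.2.1) ?_ ?_ ?_
  · rintro ⟨J, j⟩ ha ⟨J', j'⟩ hb ⟨J'', j''⟩ hc h1 h2
    obtain ⟨rfl, rfl⟩ := h1.unique h2 (mem_sigma.1 ha).1 (mem_sigma.1 hb).1 (mem_sigma.1 hc).1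
    rfl
  · rintro ⟨J, j⟩ ha ⟨J', j'⟩ hb h
    obtain ⟨hJ, hj⟩ := mem_sigma.1 ha
    obtain ⟨hJ', hj'⟩ := mem_sigma.1 hb
    dsimp only at hJ hj hJ' hj' h ⊢
    have hdet := det_ne_zero_of_mem_vertices hJ
    have hdet' := det_ne_zero_of_mem_vertices hJ'
    have e1 := h.weight_eq hJ hJ' ε
    have e2 := h.weight_eq hJ hJ' d
    have n1 := hd.2 J hJ j hj
    have n2 := hd.2 J' hJ' j' hj'
    have n3 : ((|(X.Qsub J').det| : ℤ) : ℂ) ≠ 0 := by exact_mod_cast abs_ne_zero.2 hdet'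
    have n4 : ((|(X.Qsub J).det| : ℤ) : ℂ) ≠ 0 := by exact_mod_cast abs_ne_zero.2 hdet
    have ea : -X.weight J' j' ε / X.weight J' j' d = -X.weight J j ε / X.weight J j d := by
      rw [div_eq_div_iff n2 n1]
      refine mul_left_cancel₀ n3 ?_
      linear_combination -X.weight J j d * e1 + X.weight J j ε * e2
    have hpole := h.pole_eq hdet hdet' (hroot J hJ j hj)
    have hprod : ∏ l ∈ (co J').erase j', X.weight J' l
          (ε + (-X.weight J j ε / X.weight J j d) • d)
        = ∏ l ∈ (co J).erase j, X.weight J l (ε + (-X.weight J j ε / X.weight J j d) • d) := by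
      rw [h.co_erase]
      exact prod_congr rfl fun l _ => by rw [X.weight_apply J' l, X.weight_apply J l, hpole]
    simp only [lineResidue, ea, hprod, e2, hpole]
    rw [neg_mul, div_neg, add_neg_cancel]
  · rintro ⟨J, j⟩ ha hno
    obtain ⟨hJ, hj⟩ := mem_sigma.1 ha
    dsimp only at hJ hj hno ⊢
    rw [lineResidue]
    -- On an unmatched edge every compact index lies in `J ∪ {j}`, since otherwise `exists_exchange`
    -- would give a second vertex; so `hf` applies.
    rw [hf, zero_div]
    · exact X.parameters.add_mem hε (X.parameters.smul_mem _ hd.1)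
    · intro I hI
      by_cases hIJ : I ∈ Set.range J
      · obtain ⟨k, rfl⟩ := hIJ
        exact X.x_pole_mem (det_ne_zero_of_mem_vertices hJ) _ k
      · by_cases hIj : I = j
        · subst hIj
          rw [← weight_apply]
          exact hroot J hJ I hj
        · obtain ⟨J', hJ', j', h⟩ := exists_exchange hJ (mem_co.1 hj) hI hIJ hIj
          exact absurd h (hno ⟨J', j'⟩ (mem_sigma.2 ⟨hJ', mem_co.2 h.symm.1⟩))

end ToricCY3

namespace ToricCY3

open Finset Filter Topology

variable {r : ℕ} {X : ToricCY3 r}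

/-! ### Analyticity of the mean over the line -/

/-- The function `z ↦ l (ε + z d)` on the unit circle. -/
noncomputable def alongLine (l : (Fin (r + 3) → ℂ) →ₗ[ℂ] ℂ) (d ε : Fin (r + 3) → ℂ) :
    C(Circle, ℂ) :=
  l ε • 1 + l d • ⟨fun z => z, by fun_prop⟩

@[simp] theorem alongLine_apply (l : (Fin (r + 3) → ℂ) →ₗ[ℂ] ℂ) (d ε : Fin (r + 3) → ℂ)
    (z : Circle) : alongLine l d ε z = l (ε + (z : ℂ) • d) := by
  rw [map_add, map_smul]
  change l ε * 1 + l d * z = l ε + z * l d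
  ring

theorem analyticAt_linear (l : (Fin (r + 3) → ℂ) →ₗ[ℂ] ℂ) (ε : Fin (r + 3) → ℂ) :
    AnalyticAt ℂ (fun ε => l ε) ε :=
  (LinearMap.toContinuousLinearMap l).analyticAt ε

theorem analyticAt_alongLine (l : (Fin (r + 3) → ℂ) →ₗ[ℂ] ℂ) (d ε : Fin (r + 3) → ℂ) :
    AnalyticAt ℂ (alongLine l d) ε :=
  ((analyticAt_linear l ε).smul analyticAt_const).add analyticAt_const

variable (X) in
/-- The pairing of `t` with the pole attached to `J`, as a linear function of the equivariant
parameters. -/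
noncomputable def pairing (J : Fin r → Fin (r + 3)) (t : Fin r → ℂ) :
    (Fin (r + 3) → ℂ) →ₗ[ℂ] ℂ :=
  ∑ a, t a • (LinearMap.proj a ∘ₗ X.poleL J)

theorem pairing_apply (J : Fin r → Fin (r + 3)) (t : Fin r → ℂ) (ε : Fin (r + 3) → ℂ) :
    X.pairing J t ε = ∑ a, t a * X.pole J ε a := by
  simp [pairing, LinearMap.sum_apply]

theorem numerator_pole (p : MvPolynomial (Fin (r + 3)) ℂ) (t t' : Fin r → ℂ)
    (J : Fin r → Fin (r + 3)) (ε : Fin (r + 3) → ℂ) : X.numerator p t t' ε (X.pole J ε)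
      = (Complex.exp (X.pairing J t ε) - Complex.exp (X.pairing J t' ε))
        * MvPolynomial.eval (fun i => X.weight J i ε) p := by
  simp only [numerator, pairing_apply, weight_apply]

theorem analyticAt_numerator (p : MvPolynomial (Fin (r + 3)) ℂ) (t t' : Fin r → ℂ)
    (J : Fin r → Fin (r + 3)) (ε : Fin (r + 3) → ℂ) :
    AnalyticAt ℂ (fun ε => X.numerator p t t' ε (X.pole J ε)) ε := by
  simp only [numerator_pole]
  refine ((analyticAt_linear _ ε).cexp.sub (analyticAt_linear _ ε).cexp).mul ?_
  have := AnalyticAt.aeval_mvPolynomial (𝕜 := ℂ) (f := fun ε i => X.weight J i ε) (z := ε)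
    (fun i => analyticAt_linear (X.weight J i) ε) p
  simpa only [MvPolynomial.aeval_eq_eval] using this

variable (X) in
/-- The contribution of the vertex `J` to the integrand, on the circle of parameters `ε + z d`. -/
noncomputable def vertexTerm (p : MvPolynomial (Fin (r + 3)) ℂ) (t t' : Fin r → ℂ)
    (d : Fin (r + 3) → ℂ) (J : Fin r → Fin (r + 3)) (ε : Fin (r + 3) → ℂ) : C(Circle, ℂ) :=
  (NormedSpace.exp (alongLine (X.pairing J t) d ε)
      - NormedSpace.exp (alongLine (X.pairing J t') d ε))
    * MvPolynomial.aeval (fun i => alongLine (X.weight J i) d ε) p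
    * ((((|(X.Qsub J).det| : ℤ) : ℂ)⁻¹) •
      Ring.inverse (∏ i ∈ co J, alongLine (X.weight J i) d ε))

/-- On |z| = 1 the term z w(d) dominates w(ε), so no weight vanishes. -/
theorem isUnit_prod_alongLine {d ε : Fin (r + 3) → ℂ} {J : Fin r → Fin (r + 3)}
    (hlt : ∀ i ∈ co J, ‖X.weight J i ε‖ < ‖X.weight J i d‖) :
    IsUnit (∏ i ∈ co J, alongLine (X.weight J i) d ε) := by
  refine (ContinuousMap.isUnit_iff_forall_ne_zero _).2 fun z => ?_
  rw [ContinuousMap.prod_apply]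
  refine prod_ne_zero_iff.2 fun i hi h0 => ?_
  rw [alongLine_apply, map_add, map_smul, smul_eq_mul] at h0
  have := congrArg norm (eq_neg_of_add_eq_zero_left h0)
  rw [norm_neg, norm_mul, Circle.norm_coe, one_mul] at this
  exact (hlt i hi).ne this

/-- In the Banach algebra C(Circle, ℂ) analyticity comes from the exponential and from inversion at
units. Composition with the continuous functional `circleMean` then needs no differentiation under
the integral. -/
theorem analyticAt_vertexTerm (p : MvPolynomial (Fin (r + 3)) ℂ) (t t' : Fin r → ℂ)
    {d ε : Fin (r + 3) → ℂ} {J : Fin r → Fin (r + 3)}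
    (hlt : ∀ i ∈ co J, ‖X.weight J i ε‖ < ‖X.weight J i d‖) :
    AnalyticAt ℂ (X.vertexTerm p t t' d J) ε := by
  have hexp : ∀ t, AnalyticAt ℂ
      (fun ε => NormedSpace.exp (alongLine (X.pairing J t) d ε)) ε := fun t =>
    (NormedSpace.exp_analytic (𝕂 := ℂ) (alongLine (X.pairing J t) d ε)).comp
      (analyticAt_alongLine (X.pairing J t) d ε)
  have hinv : AnalyticAt ℂ
      (fun ε => Ring.inverse (∏ i ∈ co J, alongLine (X.weight J i) d ε)) ε := by
    obtain ⟨u, hu⟩ := isUnit_prod_alongLine hlt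
    have h1 := analyticAt_inverse (𝕜 := ℂ) u
    rw [hu] at h1
    have h2 : AnalyticAt ℂ (fun ε => ∏ i ∈ co J, alongLine (X.weight J i) d ε) ε :=
      Finset.analyticAt_fun_prod _ fun i _ => analyticAt_alongLine (X.weight J i) d ε
    exact AnalyticAt.comp (f := fun ε => ∏ i ∈ co J, alongLine (X.weight J i) d ε) h1 h2
  exact (((hexp t).sub (hexp t')).mul (AnalyticAt.aeval_mvPolynomial
    (fun i => analyticAt_alongLine (X.weight J i) d ε) p)).mul (analyticAt_const.fun_smul hinv)

theorem exp_apply (f : C(Circle, ℂ)) (z : Circle) : NormedSpace.exp f z = Complex.exp (f z) := by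
  rw [Complex.exp_eq_exp_ℂ]
  exact NormedSpace.map_exp (ContinuousMap.evalAlgHom ℂ ℂ z)
    (continuous_eval_const z) f

theorem vertexTerm_apply (p : MvPolynomial (Fin (r + 3)) ℂ) (t t' : Fin r → ℂ)
    {d ε : Fin (r + 3) → ℂ} {J : Fin r → Fin (r + 3)}
    (hlt : ∀ i ∈ co J, ‖X.weight J i ε‖ < ‖X.weight J i d‖) (z : Circle) :
    X.vertexTerm p t t' d J ε z
      = X.numerator p t t' (ε + (z : ℂ) • d) (X.pole J (ε + (z : ℂ) • d)) /
      (((|(X.Qsub J).det| : ℤ) : ℂ) * ∏ i ∈ co J, X.weight J i (ε + (z : ℂ) • d)) := by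
  have hinv : Ring.inverse (∏ i ∈ co J, alongLine (X.weight J i) d ε) z
      = (∏ i ∈ co J, X.weight J i (ε + (z : ℂ) • d))⁻¹ := by
    have := congrArg (fun f : C(Circle, ℂ) => f z)
      (Ring.mul_inverse_cancel _ (isUnit_prod_alongLine hlt))
    simp only [ContinuousMap.mul_apply, ContinuousMap.prod_apply, alongLine_apply,
      ContinuousMap.one_apply] at this
    exact (inv_eq_of_mul_eq_one_right this).symm
  have haeval : MvPolynomial.aeval (fun i => alongLine (X.weight J i) d ε) p z
      = MvPolynomial.eval (fun i => X.weight J i (ε + (z : ℂ) • d)) p := by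
    have := MvPolynomial.map_aeval (R := ℂ) (fun i => alongLine (X.weight J i) d ε)
      (ContinuousMap.evalAlgHom ℂ ℂ z : C(Circle, ℂ) →ₐ[ℂ] ℂ).toRingHom p
    simp only [AlgHom.toRingHom_eq_coe, RingHom.coe_coe, ContinuousMap.evalAlgHom_apply,
      alongLine_apply] at this
    rw [this, MvPolynomial.coe_eval₂Hom]
    rfl
  simp only [vertexTerm, ContinuousMap.mul_apply, ContinuousMap.sub_apply, exp_apply,
    alongLine_apply, ContinuousMap.smul_apply, smul_eq_mul, hinv, haeval, numerator_pole]
  rw [div_eq_mul_inv, mul_inv]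

/-- At ε = 0 the polynomial scales as z^δ and the three weights together as z³, leaving exp(u
z)/z^k. -/
theorem circleMean_vertexTerm_zero {p : MvPolynomial (Fin (r + 3)) ℂ} {δ k : ℕ}
    (hp : p.IsHomogeneous δ) (hk : δ + k = 3) (t t' : Fin r → ℂ) {d : Fin (r + 3) → ℂ}
    {J : Fin r → Fin (r + 3)} (hJ : Function.Injective J)
    (hd : ∀ i ∈ co J, X.weight J i d ≠ 0) :
    circleMean (X.vertexTerm p t t' d J 0)
      = (X.pairing J t d ^ k / k.factorial - X.pairing J t' d ^ k / k.factorial)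
        * MvPolynomial.eval (fun i => X.weight J i d) p /
      (((|(X.Qsub J).det| : ℤ) : ℂ) * ∏ i ∈ co J, X.weight J i d) := by
  have hz : ∀ z : Circle, (z : ℂ) ^ k ≠ 0 := fun z => pow_ne_zero _ z.coe_ne_zero
  let E : ℂ → C(Circle, ℂ) := fun u => ⟨fun z => Complex.exp (u * z) / (z : ℂ) ^ k, by
    exact Continuous.div (by fun_prop) (by fun_prop) hz⟩
  have hE : ∀ u, circleMean (E u) = u ^ k / k.factorial := fun u =>
    circleMean_exp_div_pow fun z => rfl
  have heq : X.vertexTerm p t t' d J 0 = (MvPolynomial.eval (fun i => X.weight J i d) p /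
      (((|(X.Qsub J).det| : ℤ) : ℂ) * ∏ i ∈ co J, X.weight J i d)) •
      (E (X.pairing J t d) - E (X.pairing J t' d)) := by
    ext z
    rw [vertexTerm_apply p t t' (by simpa using hd), numerator_pole]
    simp only [zero_add, map_smul, smul_eq_mul, hp.eval_const_mul, prod_mul_distrib, prod_const,
      card_co hJ, ContinuousMap.smul_apply, ContinuousMap.sub_apply, E, ContinuousMap.coe_mk]
    have := z.coe_ne_zero
    have h3 : (z : ℂ) ^ 3 = (z : ℂ) ^ δ * (z : ℂ) ^ k := by rw [← pow_add, hk]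
    rw [h3, mul_comm (z : ℂ) (X.pairing J t d), mul_comm (z : ℂ) (X.pairing J t' d)]
    field_simp
  rw [heq, map_smul, map_sub, hE, hE, smul_eq_mul]
  ring

/-! ### The shift equations -/

/-- Since ε_I = 0 on compact divisors, x_I is purely linear in φ there, and the shift of the
exponent is a combination of the x_I. -/
theorem sum_ψ_mul (m : X.compactDivisors → ℂ) {ε : Fin (r + 3) → ℂ} (hε : ε ∈ X.parameters)
    (φ : Fin r → ℂ) : ∑ a, X.ψ m a * φ a = -∑ I, m I * X.x ε φ I := by
  simp only [ψ, x, neg_mul, sum_neg_distrib, sum_mul, neg_inj]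
  rw [sum_comm]
  refine sum_congr rfl fun I _ => ?_
  rw [hε I I.2, zero_add, mul_sum]
  exact sum_congr rfl fun a _ => by ring

theorem numerator_eq_zero (p : MvPolynomial (Fin (r + 3)) ℂ) (t : Fin r → ℂ)
    (m : X.compactDivisors → ℂ) {ε : Fin (r + 3) → ℂ} (hε : ε ∈ X.parameters) {φ : Fin r → ℂ}
    (h : ∀ I ∈ X.compactDivisors, X.x ε φ I = 0) :
    X.numerator p t (t + X.ψ m) ε φ = 0 := by
  have : ∑ a, (t + X.ψ m) a * φ a = ∑ a, t a * φ a := by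
    simp only [Pi.add_apply, add_mul, sum_add_distrib]
    have h0 : ∑ I : X.compactDivisors, m I * X.x ε φ I = 0 :=
      sum_eq_zero fun I _ => by rw [h I I.2, mul_zero]
    rw [sum_ψ_mul m hε, h0, neg_zero, add_zero]
  rw [numerator, this, sub_self, zero_mul]

/-- The regular function that agrees with the shift of the Jeffrey-Kirwan integral. -/
theorem jkIntegral_numerator_eq (hX : X.compactDivisors.Nonempty)
    (p : MvPolynomial (Fin (r + 3)) ℂ) (t : Fin r → ℂ) (m : X.compactDivisors → ℂ)
    {d : Fin (r + 3) → ℂ} (hd : X.Admissible d) {ε : Fin (r + 3) → ℂ} (hε : X.Admissible ε)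
    (hlt : ∀ J ∈ X.vertices, ∀ i ∈ co J, ‖X.weight J i ε‖ < ‖X.weight J i d‖) :
    X.jkIntegral ε (X.numerator p t (t + X.ψ m) ε)
      = circleMean (∑ J ∈ X.vertices, X.vertexTerm p t (t + X.ψ m) d J ε) := by
  -- the case of generic `ε`
  have hgeneric : ∀ ε, X.Admissible ε →
      (∀ J ∈ X.vertices, ∀ i ∈ co J, ‖X.weight J i ε‖ < ‖X.weight J i d‖) →
      (∀ J ∈ X.vertices, ∀ i ∈ co J, ∀ l ∈ co J, i ≠ l →
        X.weight J i ε * X.weight J l d - X.weight J l ε * X.weight J i d ≠ 0) →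
      X.jkIntegral ε (X.numerator p t (t + X.ψ m) ε)
      = circleMean (∑ J ∈ X.vertices, X.vertexTerm p t (t + X.ψ m) d J ε) := by
    intro ε hε hlt hgen
    have hε' := admissible_iff.1 hε
    rw [map_sum, sum_congr rfl fun J hJ => circleMean_vertex
      (f := X.numerator p t (t + X.ψ m)) (ε := ε) (d := d) (fun z => ?_) (hε'.2 J hJ) (hlt J hJ)
      (hgen J hJ) (vertexTerm_apply p t (t + X.ψ m) (hlt J hJ)), sum_add_distrib,
      sum_lineResidue_eq_zero (fun ε hε φ h => numerator_eq_zero p t m hε h) hε'.1 hd, add_zero,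
      jkIntegral_eq]
    have h : DifferentiableAt ℂ (fun z : ℂ => ε + z • d) z := by fun_prop
    exact DifferentiableAt.comp z
      (analyticAt_numerator p t (t + X.ψ m) J (ε + z • d)).differentiableAt h
  -- approach `ε` along a generic direction
  obtain ⟨e, he, hgen⟩ := exists_generic hX hd
  have hε' := admissible_iff.1 hε
  have hlim : Tendsto (fun s : ℂ => ε + s • e) (𝓝[≠] 0) (𝓝 ε) := by
    have : Tendsto (fun s : ℂ => ε + s • e) (𝓝 0) (𝓝 (ε + (0 : ℂ) • e)) :=
      Continuous.tendsto (by fun_prop) 0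
    rw [zero_smul, add_zero] at this
    exact this.mono_left nhdsWithin_le_nhds
  have hw : ∀ J i, ContinuousAt (fun ε => X.weight J i ε) ε := fun J i =>
    (analyticAt_linear _ ε).continuousAt
  have e1 : ∀ᶠ s in 𝓝[≠] (0 : ℂ), X.Admissible (ε + s • e) := by
    have : ∀ᶠ ε' in 𝓝 ε, ∀ J ∈ X.vertices, ∀ i ∈ co J, X.weight J i ε' ≠ 0 :=
      (eventually_all_finset _).2 fun J hJ => (eventually_all_finset _).2 fun i hi =>
        (hw J i).eventually_ne (hε'.2 J hJ i hi)
    filter_upwards [hlim.eventually this] with s hs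
    exact admissible_iff.2 ⟨X.parameters.add_mem hε'.1 (X.parameters.smul_mem s he), hs⟩
  have e2 : ∀ᶠ ε' in 𝓝 ε, ∀ J ∈ X.vertices, ∀ i ∈ co J,
      ‖X.weight J i ε'‖ < ‖X.weight J i d‖ :=
    (eventually_all_finset _).2 fun J hJ => (eventually_all_finset _).2 fun i hi =>
      (hw J i).norm.eventually_lt continuousAt_const (hlt J hJ i hi)
  have e3 : ∀ᶠ s in 𝓝[≠] (0 : ℂ), ∀ J ∈ X.vertices, ∀ i ∈ co J, ∀ l ∈ co J, i ≠ l →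
      X.weight J i (ε + s • e) * X.weight J l d - X.weight J l (ε + s • e) * X.weight J i d
        ≠ 0 := by
    refine (eventually_all_finset _).2 fun J hJ => (eventually_all_finset _).2 fun i hi =>
      (eventually_all_finset _).2 fun l hl => ?_
    by_cases hil : i = l
    · exact Eventually.of_forall fun _ h => absurd hil h
    · set b := X.weight J i ε * X.weight J l d - X.weight J l ε * X.weight J i d with hb
      set c := X.weight J i e * X.weight J l d - X.weight J l e * X.weight J i d with hc
      have hc0 : c ≠ 0 := hgen J hJ i hi l hl hil
      -- The determinant is affine in `s` with nonzero slope, so it has no zero in a small punctured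
      -- disc.
      have hne : ∀ᶠ s in 𝓝[≠] (0 : ℂ), b + s * c ≠ 0 := by
        by_cases hb0 : b = 0
        · filter_upwards [self_mem_nhdsWithin] with s hs
          rw [hb0, zero_add]
          exact mul_ne_zero hs hc0
        · have : ContinuousAt (fun s : ℂ => b + s * c) 0 := by fun_prop
          exact (this.eventually_ne (by simpa using hb0)).filter_mono nhdsWithin_le_nhds
      filter_upwards [hne] with s hs _ h
      refine hs ?_
      rw [← h]
      simp only [map_add, map_smul, smul_eq_mul, hb, hc]
      ring
  -- Both sides are continuous at `ε` even where roots collide, so the identity passes to the limit.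
  have hleft : ContinuousAt (fun ε => X.jkIntegral ε (X.numerator p t (t + X.ψ m) ε)) ε := by
    simp only [jkIntegral_eq]
    refine tendsto_finsetSum _ fun J hJ => ?_
    refine (analyticAt_numerator p t (t + X.ψ m) J ε).continuousAt.div
      (continuousAt_const.mul (tendsto_finsetProd _ fun i _ => hw J i)) ?_
    exact mul_ne_zero (by exact_mod_cast abs_ne_zero.2 (det_ne_zero_of_mem_vertices hJ))
      (prod_ne_zero_iff.2 (hε'.2 J hJ))
  have hright : ContinuousAt
      (fun ε => circleMean (∑ J ∈ X.vertices, X.vertexTerm p t (t + X.ψ m) d J ε)) ε :=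
    circleMean.continuous.continuousAt.comp (tendsto_finsetSum _ fun J hJ =>
      (analyticAt_vertexTerm p t (t + X.ψ m) (hlt J hJ)).continuousAt)
  refine tendsto_nhds_unique (hleft.tendsto.comp hlim)
    ((hright.tendsto.comp hlim).congr' ?_)
  filter_upwards [e1, hlim.eventually e2, e3] with s h1 h2 h3
  exact (hgeneric _ h1 h2 h3).symm

/-- The shift of a Jeffrey-Kirwan integral agrees up to `O(ε)` with its part of degree zero. -/
theorem isOε_jkIntegral_shift (hX : X.compactDivisors.Nonempty)
    {p : MvPolynomial (Fin (r + 3)) ℂ} {δ k : ℕ} (hp : p.IsHomogeneous δ) (hk : δ + k = 3)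
    {d : Fin (r + 3) → ℂ} (hd : X.Admissible d) (t : Fin r → ℂ) (m : X.compactDivisors → ℂ) :
    X.IsOε fun ε =>
      X.jkIntegral ε (fun φ => Complex.exp (∑ a, t a * φ a) * MvPolynomial.eval (X.x ε φ) p)
      - X.jkIntegral ε
        (fun φ => Complex.exp (∑ a, (t + X.ψ m) a * φ a) * MvPolynomial.eval (X.x ε φ) p)
      - ∑ J ∈ X.vertices,
        (X.pairing J t d ^ k / k.factorial - X.pairing J (t + X.ψ m) d ^ k / k.factorial)
        * MvPolynomial.eval (fun i => X.weight J i d) p /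
      (((|(X.Qsub J).det| : ℤ) : ℂ) * ∏ i ∈ co J, X.weight J i d) := by
  have hd' := (admissible_iff.1 hd).2
  refine ⟨fun ε => circleMean (∑ J ∈ X.vertices, X.vertexTerm p t (t + X.ψ m) d J ε)
    - ∑ J ∈ X.vertices,
        (X.pairing J t d ^ k / k.factorial - X.pairing J (t + X.ψ m) d ^ k / k.factorial)
        * MvPolynomial.eval (fun i => X.weight J i d) p /
      (((|(X.Qsub J).det| : ℤ) : ℂ) * ∏ i ∈ co J, X.weight J i d), ?_, ?_, ?_⟩
  · refine AnalyticAt.sub ?_ analyticAt_const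
    refine (circleMean.analyticAt _).comp (Finset.analyticAt_fun_sum _ fun J hJ => ?_)
    exact analyticAt_vertexTerm p t (t + X.ψ m) (by simpa using hd' J hJ)
  · beta_reduce
    rw [map_sum, sub_eq_zero]
    exact sum_congr rfl fun J hJ => circleMean_vertexTerm_zero hp hk t _
      (mem_vertices.1 hJ).1.injective (hd' J hJ)
  · have hlt : ∀ᶠ ε in 𝓝 0, ∀ J ∈ X.vertices, ∀ i ∈ co J,
        ‖X.weight J i ε‖ < ‖X.weight J i d‖ :=
      (eventually_all_finset _).2 fun J hJ => (eventually_all_finset _).2 fun i hi =>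
        (analyticAt_linear _ 0).continuousAt.norm.eventually_lt continuousAt_const
          (by simpa using hd' J hJ i hi)
    filter_upwards [hlt] with ε hlt hε
    rw [← jkIntegral_numerator_eq hX p t m hd hε hlt]
    congr 1
    simp only [jkIntegral_eq, numerator, sub_mul, sub_div, sum_sub_distrib]

end ToricCY3

namespace ToricCY3

open Finset

/-! ### Scalar summation identities -/

section Scalar

variable {n : ℕ} {e g : ℂ}

/-- Extension by zero of a finite sequence. -/
noncomputable def extendFin (a : Fin n → ℂ) (k : ℕ) : ℂ := if h : k < n then a ⟨k, h⟩ else 0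

theorem extendFin_coe (a : Fin n → ℂ) (p : Fin n) : extendFin a p = a p := by
  simp [extendFin]

theorem sum_fin_eq_range (a : Fin n → ℂ) : ∑ p, a p = ∑ k ∈ range n, extendFin a k := by
  rw [← Fin.sum_univ_eq_sum_range]
  exact sum_congr rfl fun p _ => (extendFin_coe a p).symm

theorem sum_Iio_eq_range (f : ℕ → ℂ) (p : Fin n) :
    ∑ q ∈ Iio p, f q = ∑ q ∈ range (p : ℕ), f q := by
  have := Fin.map_valEmbedding_Iio p
  rw [Nat.Iio_eq_range] at this
  rw [← this, sum_map]
  rfl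

theorem sum_Ioi_eq (a : Fin n → ℂ) (ha : ∑ p, a p = 0) (p : Fin n) :
    ∑ q ∈ Ioi p, a q = -∑ k ∈ range ((p : ℕ) + 1), extendFin a k := by
  have h : ∑ q ∈ Ioi p, a q = ∑ q ∈ Ico ((p : ℕ) + 1) n, extendFin a q := by
    have h1 : (Ioi p).map Fin.valEmbedding = Ico ((p : ℕ) + 1) n := by
      ext k
      simp only [Finset.mem_map, mem_Ioi, Fin.valEmbedding_apply, mem_Ico, Fin.lt_def]
      constructor
      · rintro ⟨q, hq, rfl⟩
        exact ⟨hq, q.2⟩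
      · rintro ⟨h1, h2⟩
        exact ⟨⟨k, h2⟩, h1, rfl⟩
    rw [← h1, sum_map]
    exact sum_congr rfl fun q _ => (extendFin_coe a q).symm
  rw [sum_fin_eq_range, ← sum_range_add_sum_Ico _ (show (p : ℕ) + 1 ≤ n from p.2)] at ha
  rw [h, eq_neg_of_add_eq_zero_right ha]

/-- The parameters `h_k = g + (e/2) (n - 2k)` interpolating between the `g_p`. -/
noncomputable def coupling (n : ℕ) (e g : ℂ) (k : ℕ) : ℂ := g + e / 2 * (n - 2 * k)

theorem gp_eq (p : Fin n) : gp e g p = coupling n e g p - e / 2 := by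
  rw [gp, coupling]
  ring

theorem coupling_succ (k : ℕ) : coupling n e g (k + 1) = coupling n e g k - e := by
  rw [coupling, coupling]
  push_cast
  ring

/-- Each g_p is the midpoint of two consecutive couplings, which differ by `e`; hence the difference
of squares factors. -/
theorem den_eq (p : Fin n) :
    (e / 2) ^ 2 - gp e g p ^ 2 = -(coupling n e g p * coupling n e g ((p : ℕ) + 1)) := by
  rw [gp_eq, coupling_succ]
  ring

theorem coupling_ne_zero (hn : 1 ≤ n) (h : ∀ p : Fin n, (e / 2) ^ 2 - gp e g p ^ 2 ≠ 0) {k : ℕ}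
    (hkn : k ≤ n) : coupling n e g k ≠ 0 := by
  rcases Nat.lt_or_ge k n with hlt | hge
  · have := h ⟨k, hlt⟩
    rw [den_eq, neg_ne_zero] at this
    exact left_ne_zero_of_mul this
  · obtain ⟨l, rfl⟩ : ∃ l, n = l + 1 := ⟨n - 1, by omega⟩
    obtain rfl : k = l + 1 := by omega
    have := h ⟨l, by omega⟩
    rw [den_eq, neg_ne_zero] at this
    exact right_ne_zero_of_mul this

/-- The sum telescopes, but writing its terms as differences would require dividing by `e`. The
closed form of the partial sums is also valid for e = 0. -/
theorem sum_inv_den (hn : 1 ≤ n) (h : ∀ p : Fin n, (e / 2) ^ 2 - gp e g p ^ 2 ≠ 0) :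
    ∑ p : Fin n, 1 / ((e / 2) ^ 2 - gp e g p ^ 2) = n / ((n * e / 2) ^ 2 - g ^ 2) := by
  have key : ∀ k ≤ n, ∑ l ∈ range k, 1 / -(coupling n e g l * coupling n e g (l + 1))
      = -k / (coupling n e g 0 * coupling n e g k) := by
    intro k
    induction k with
    | zero => simp
    | succ k ih =>
      intro hkn
      have h0 := coupling_ne_zero hn h (Nat.zero_le n)
      have h1 := coupling_ne_zero hn h (show k ≤ n by omega)
      have h2 := coupling_ne_zero hn h hkn
      rw [sum_range_succ, ih (by omega)]
      field_simp
      simp only [coupling]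
      push_cast
      ring
  simp only [den_eq]
  rw [Fin.sum_univ_eq_sum_range (fun l => 1 / -(coupling n e g l * coupling n e g (l + 1))), key n le_rfl]
  have : (n * e / 2) ^ 2 - g ^ 2 = -(coupling n e g 0 * coupling n e g n) := by
    simp only [coupling]
    push_cast
    ring
  rw [this, div_neg, neg_div]

/-- The scalar form of `g_p α^p + (e/2) σ^p`. -/
noncomputable def shiftScalar (e g : ℂ) (a : Fin n → ℂ) (p : Fin n) : ℂ :=
  gp e g p * a p + e / 2 * (∑ s ∈ Iio p, a s - ∑ s ∈ Ioi p, a s)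

/-- As the total vanishes, the tail sum is minus a partial sum. With a_p = S_{p+1} - S_p the shift
collapses to two terms. -/
theorem shiftScalar_eq {a : Fin n → ℂ} (ha : ∑ p, a p = 0) (p : Fin n) :
    shiftScalar e g a p = coupling n e g p * ∑ k ∈ range ((p : ℕ) + 1), extendFin a k
      - coupling n e g ((p : ℕ) + 1) * ∑ k ∈ range p, extendFin a k := by
  have h1 : ∑ s ∈ Iio p, a s = ∑ k ∈ range p, extendFin a k := by
    rw [← sum_Iio_eq_range]
    exact sum_congr rfl fun q _ => (extendFin_coe a q).symm
  rw [shiftScalar, sum_Ioi_eq a ha, h1, gp_eq, coupling_succ, sum_range_succ, extendFin_coe]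
  ring

/-- The cube of a_k enters n - 1 - k times as the earlier index and k times, negated, as the later
one. The final product drops out when the total is zero. -/
theorem sum_sum_sub_pow_three (a : ℕ → ℂ) (n : ℕ) :
    ∑ k ∈ range n, ∑ q ∈ range k, (a q - a k) ^ 3
      = ∑ k ∈ range n, ((n - 1 - 2 * k) * a k ^ 3
          + 3 * a k ^ 2 * (∑ q ∈ range k, a q + ∑ q ∈ range (k + 1), a q))
        - 3 * (∑ q ∈ range n, a q) * ∑ k ∈ range n, a k ^ 2 := by
  induction n with
  | zero => simp
  | succ n ih =>
    have h1 : ∑ q ∈ range n, (a q - a n) ^ 3 = ∑ q ∈ range n, a q ^ 3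
        - 3 * a n * ∑ q ∈ range n, a q ^ 2 + 3 * a n ^ 2 * ∑ q ∈ range n, a q - n * a n ^ 3 := by
      rw [mul_sum, mul_sum, ← sum_sub_distrib, ← sum_add_distrib]
      have : (n : ℂ) * a n ^ 3 = ∑ q ∈ range n, a n ^ 3 := by simp
      rw [this, ← sum_sub_distrib]
      exact sum_congr rfl fun q _ => by ring
    have h2 : ∑ k ∈ range n, ((((n + 1 : ℕ) : ℂ) - 1 - 2 * k) * a k ^ 3
          + 3 * a k ^ 2 * (∑ q ∈ range k, a q + ∑ q ∈ range (k + 1), a q))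
        = ∑ k ∈ range n, (((n : ℂ) - 1 - 2 * k) * a k ^ 3
          + 3 * a k ^ 2 * (∑ q ∈ range k, a q + ∑ q ∈ range (k + 1), a q))
          + ∑ k ∈ range n, a k ^ 3 := by
      rw [← sum_add_distrib]
      exact sum_congr rfl fun q _ => by push_cast; ring
    rw [sum_range_succ, ih, sum_range_succ _ n, sum_range_succ (fun k => a k ^ 2), h1, h2]
    simp only [sum_range_succ a n]
    push_cast
    ring

theorem sum_sum_Iio_eq (f : ℂ → ℂ) (a : Fin n → ℂ) :
    ∑ p, ∑ q ∈ Iio p, f (a q - a p)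
      = ∑ k ∈ range n, ∑ q ∈ range k, f (extendFin a q - extendFin a k) := by
  rw [← Fin.sum_univ_eq_sum_range
    (fun k => ∑ q ∈ range k, f (extendFin a q - extendFin a k))]
  refine sum_congr rfl fun p _ => ?_
  rw [← sum_Iio_eq_range (fun q => f (extendFin a q - extendFin a p)) p]
  exact sum_congr rfl fun q _ => by rw [extendFin_coe, extendFin_coe]

theorem sum_fin_telescope {Φ T : ℕ → ℂ} (h0 : Φ 0 = 0) (hn : Φ n = 0)
    (h : ∀ k < n, T k = Φ (k + 1) - Φ k) : ∑ k ∈ range n, T k = 0 := by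
  rw [sum_congr rfl fun k hk => h k (mem_range.1 hk), sum_range_sub, h0, hn, sub_zero]

/-- The factorization identity for the cube of a linear form. -/
theorem cubic_factorization (hn : 1 ≤ n) (h : ∀ p : Fin n, (e / 2) ^ 2 - gp e g p ^ 2 ≠ 0)
    {a : Fin n → ℂ} (ha : ∑ p, a p = 0) (u : ℂ) :
    ∑ p, (u ^ 3 - (u + shiftScalar e g a p) ^ 3) / ((e / 2) ^ 2 - gp e g p ^ 2)
      + ∑ p, -3 * u * a p ^ 2 + g * ∑ p, -a p ^ 3
      + e / 2 * ∑ p, ∑ q ∈ Iio p, -(a q - a p) ^ 3 = 0 := by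
  set b := extendFin a with hb
  set S : ℕ → ℂ := fun k => ∑ q ∈ range k, b q with hS
  have hS0 : S 0 = 0 := by simp [hS]
  have hSn : S n = 0 := by rw [← ha, sum_fin_eq_range]
  have hd : ∑ p, ∑ q ∈ Iio p, -(a q - a p) ^ 3
      = ∑ k ∈ range n, -((n - 1 - 2 * k) * b k ^ 3 + 3 * b k ^ 2 * (S k + S (k + 1))) := by
    rw [sum_sum_Iio_eq (fun y => -y ^ 3)]
    simp only [sum_neg_distrib]
    rw [sum_sum_sub_pow_three]
    change -(_ - 3 * S n * _) = _
    rw [hSn]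
    simp [hS, hb]
  have h1 : ∑ p, (u ^ 3 - (u + shiftScalar e g a p) ^ 3) / ((e / 2) ^ 2 - gp e g p ^ 2)
      = ∑ k ∈ range n, (u ^ 3 - (u + (coupling n e g k * S (k + 1) - coupling n e g (k + 1) * S k)) ^ 3)
        / -(coupling n e g k * coupling n e g (k + 1)) := by
    rw [← Fin.sum_univ_eq_sum_range (fun k =>
      (u ^ 3 - (u + (coupling n e g k * S (k + 1) - coupling n e g (k + 1) * S k)) ^ 3)
        / -(coupling n e g k * coupling n e g (k + 1)))]
    exact sum_congr rfl fun p _ => by rw [den_eq, shiftScalar_eq ha]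
  have h2 : ∑ p, -3 * u * a p ^ 2 = ∑ k ∈ range n, -3 * u * b k ^ 2 := by
    rw [← Fin.sum_univ_eq_sum_range (fun k => -3 * u * b k ^ 2)]
    exact sum_congr rfl fun p _ => by rw [hb, extendFin_coe]
  have h3 : ∑ p, -a p ^ 3 = ∑ k ∈ range n, -b k ^ 3 := by
    rw [← Fin.sum_univ_eq_sum_range (fun k => -b k ^ 3)]
    exact sum_congr rfl fun p _ => by rw [hb, extendFin_coe]
  rw [hd, h1, h2, h3, mul_sum, mul_sum, ← sum_add_distrib, ← sum_add_distrib, ← sum_add_distrib]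
  -- All four sums combine into differences of this potential, which vanishes at both ends because S
  -- does.
  refine sum_fin_telescope (Φ := fun k =>
    (3 * u ^ 2 * S k + 3 * u * e * S k ^ 2 + e ^ 2 * S k ^ 3) / coupling n e g k)
    (by simp [hS0]) (by simp [hSn]) fun k hkn => ?_
  have n1 := coupling_ne_zero hn h (show k ≤ n by omega)
  have n2 := coupling_ne_zero hn h (show k + 1 ≤ n by omega)
  have hb' : b k = S (k + 1) - S k := by simp [hS, sum_range_succ]
  -- With `g` and `e` eliminated, the step is a rational identity in two consecutive couplings and
  -- two consecutive partial sums.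
  have hg : g = coupling n e g k - e / 2 * (n - 2 * k) := by rw [coupling]; ring
  have he : e = coupling n e g k - coupling n e g (k + 1) := by rw [coupling_succ]; ring
  rw [hb']
  generalize coupling n e g k = x at *
  generalize coupling n e g (k + 1) = y at *
  generalize S (k + 1) = A
  generalize S k = B
  subst hg he
  field_simp
  ring

/-- The factorization identity for a linear form. -/
theorem linear_factorization {a : Fin n → ℂ} (ha : ∑ p, a p = 0) :
    e / 2 * ∑ p, ∑ q ∈ Iio p, (a q - a p) = 1 / 2 * ∑ p, shiftScalar e g a p := by
  set b := extendFin a with hb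
  set S : ℕ → ℂ := fun k => ∑ q ∈ range k, b q with hS
  have hS0 : S 0 = 0 := by simp [hS]
  have hSn : S n = 0 := by rw [← ha, sum_fin_eq_range]
  have h1 : ∑ p, shiftScalar e g a p
      = ∑ k ∈ range n, (coupling n e g k * S (k + 1) - coupling n e g (k + 1) * S k) := by
    rw [← Fin.sum_univ_eq_sum_range (fun k =>
      coupling n e g k * S (k + 1) - coupling n e g (k + 1) * S k)]
    exact sum_congr rfl fun p _ => by rw [shiftScalar_eq ha]
  have h2 : ∑ p, ∑ q ∈ Iio p, (a q - a p) = ∑ k ∈ range n, (S k - k * b k) := by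
    rw [sum_sum_Iio_eq fun y => y]
    exact sum_congr rfl fun k _ => by simp [sum_sub_distrib, hS, hb]
  rw [h1, h2, ← sub_eq_zero, mul_sum, mul_sum, ← sum_sub_distrib]
  -- The terms with coefficient `k` cancel between the two sides, so the potential is a constant
  -- multiple of S.
  refine sum_fin_telescope (Φ := fun k => -(g / 2 + e * n / 4) * S k) (by simp [hS0])
    (by simp [hSn]) fun k _ => ?_
  have hb' : b k = S (k + 1) - S k := by simp [hS, sum_range_succ]
  rw [hb', coupling, coupling]
  push_cast
  ring

end Scalar

end ToricCY3

namespace ToricCY3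

open Finset Filter Topology MvPolynomial

variable {r : ℕ} {X : ToricCY3 r}

/-! ### Equality up to `O(ε)` -/

theorem IsOε.congr {E E' : (Fin (r + 3) → ℂ) → ℂ} (h : X.IsOε E) (heq : ∀ ε, E' ε = E ε) :
    X.IsOε E' := by
  rwa [show E' = E from funext heq]

theorem IsOε.add {E E' : (Fin (r + 3) → ℂ) → ℂ} (h : X.IsOε E) (h' : X.IsOε E') :
    X.IsOε fun ε => E ε + E' ε := by
  obtain ⟨G, hG, hG0, hE⟩ := h
  obtain ⟨G', hG', hG0', hE'⟩ := h'
  refine ⟨fun ε => G ε + G' ε, hG.add hG', by simp [hG0, hG0'], ?_⟩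
  filter_upwards [hE, hE'] with ε h h' hε
  rw [h hε, h' hε]

theorem IsOε.const_mul {E : (Fin (r + 3) → ℂ) → ℂ} (h : X.IsOε E) (c : ℂ) :
    X.IsOε fun ε => c * E ε := by
  obtain ⟨G, hG, hG0, hE⟩ := h
  refine ⟨fun ε => c * G ε, analyticAt_const.mul hG, by simp [hG0], ?_⟩
  filter_upwards [hE] with ε h hε
  rw [h hε]

theorem IsOε.sum {ι : Type*} {s : Finset ι} {E : ι → (Fin (r + 3) → ℂ) → ℂ}
    (h : ∀ i ∈ s, X.IsOε (E i)) : X.IsOε fun ε => ∑ i ∈ s, E i ε := by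
  classical
  induction s using Finset.induction_on with
  | empty => exact ⟨0, analyticAt_const, rfl, by simp⟩
  | insert i s hi ih =>
    refine ((h i (mem_insert_self i s)).add
      (ih fun k hk => h k (mem_insert_of_mem hk))).congr fun ε => ?_
    rw [sum_insert hi]

/-- A constant that is `O(ε)` vanishes. -/
theorem IsOε.const_eq_zero (hX : X.compactDivisors.Nonempty) {c : ℂ}
    (h : X.IsOε fun _ => c) : c = 0 := by
  obtain ⟨G, hG, hG0, hE⟩ := h
  obtain ⟨d, hd⟩ := exists_admissible hX
  have hlim : Tendsto (fun s : ℂ => s • d) (𝓝[≠] 0) (𝓝 0) := by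
    have : Tendsto (fun s : ℂ => s • d) (𝓝 0) (𝓝 ((0 : ℂ) • d)) :=
      Continuous.tendsto (by fun_prop) 0
    rw [zero_smul] at this
    exact this.mono_left nhdsWithin_le_nhds
  have h1 : Tendsto (fun s : ℂ => G (s • d)) (𝓝[≠] 0) (𝓝 (G 0)) :=
    hG.continuousAt.tendsto.comp hlim
  rw [hG0] at h1
  refine tendsto_nhds_unique ((tendsto_const_nhds (x := c)).congr' ?_) h1
  filter_upwards [hlim.eventually hE, self_mem_nhdsWithin] with s hs hs0
  exact hs (hd.smul hs0)

/-- The difference of the values at each (t, m) is a constant that is O(ε), hence zero. -/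
theorem IsCubicShift.unique (hX : X.compactDivisors.Nonempty)
    {P P' : MvPolynomial (Fin r ⊕ X.compactDivisors) ℂ} (h : X.IsCubicShift P)
    (h' : X.IsCubicShift P') : P = P' := by
  refine MvPolynomial.funext fun v => ?_
  rw [← sub_eq_zero, ← Sum.elim_comp_inl_inr v]
  refine IsOε.const_eq_zero hX (((h'.2 (v ∘ Sum.inl) (v ∘ Sum.inr)).add
    ((h.2 (v ∘ Sum.inl) (v ∘ Sum.inr)).const_mul (-1))).congr fun ε => ?_)
  ring

theorem IsLinearShift.unique (hX : X.compactDivisors.Nonempty)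
    {P P' : MvPolynomial X.compactDivisors ℂ} (h : X.IsLinearShift P)
    (h' : X.IsLinearShift P') : P = P' := by
  refine MvPolynomial.funext fun v => ?_
  rw [← sub_eq_zero]
  refine IsOε.const_eq_zero hX (((h'.2 0 v).add ((h.2 0 v).const_mul (-1))).congr fun ε => ?_)
  ring

/-! ### The shift polynomials -/

/-- The pairing of `ψ m` with the pole attached to `J`, as a linear function of `m`. -/
noncomputable def shiftPairing (X : ToricCY3 r) (d : Fin (r + 3) → ℂ) (J : Fin r → Fin (r + 3)) :
    (X.compactDivisors → ℂ) →ₗ[ℂ] ℂ :=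
  -∑ I : X.compactDivisors, (∑ a, (X.Q a I : ℂ) * X.pole J d a) • LinearMap.proj I

theorem shiftPairing_eq (d : Fin (r + 3) → ℂ) (J : Fin r → Fin (r + 3))
    (m : X.compactDivisors → ℂ) : X.shiftPairing d J m = X.pairing J (X.ψ m) d := by
  simp only [shiftPairing, LinearMap.neg_apply, LinearMap.sum_apply, LinearMap.smul_apply,
    LinearMap.proj_apply, smul_eq_mul, pairing_apply, ψ, neg_mul, sum_neg_distrib, sum_mul]
  rw [sum_comm]
  exact congrArg _ (sum_congr rfl fun _ _ => sum_congr rfl fun _ _ => by ring)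

theorem pairing_add (J : Fin r → Fin (r + 3)) (t t' : Fin r → ℂ) (d : Fin (r + 3) → ℂ) :
    X.pairing J (t + t') d = X.pairing J t d + X.pairing J t' d := by
  simp [pairing_apply, add_mul, sum_add_distrib]

/-- The linear form `pairing` as a polynomial in `t`. -/
noncomputable def pairingPoly (X : ToricCY3 r) {τ : Type*} (ι : Fin r → τ) (d : Fin (r + 3) → ℂ)
    (J : Fin r → Fin (r + 3)) : MvPolynomial τ ℂ :=
  ∑ a, C (X.pole J d a) * MvPolynomial.X (ι a)

/-- The linear form `shiftPairing` as a polynomial in `m`. -/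
noncomputable def shiftPoly (X : ToricCY3 r) {τ : Type*} (ι : X.compactDivisors → τ)
    (d : Fin (r + 3) → ℂ) (J : Fin r → Fin (r + 3)) : MvPolynomial τ ℂ :=
  ∑ I : X.compactDivisors, C (-∑ a, (X.Q a I : ℂ) * X.pole J d a) * MvPolynomial.X (ι I)

theorem eval_pairingPoly {τ : Type*} (ι : Fin r → τ) (d : Fin (r + 3) → ℂ)
    (J : Fin r → Fin (r + 3)) (v : τ → ℂ) :
    eval v (X.pairingPoly ι d J) = X.pairing J (v ∘ ι) d := by
  simp [pairingPoly, pairing_apply, mul_comm]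

theorem eval_shiftPoly {τ : Type*} (ι : X.compactDivisors → τ) (d : Fin (r + 3) → ℂ)
    (J : Fin r → Fin (r + 3)) (v : τ → ℂ) :
    eval v (X.shiftPoly ι d J) = X.shiftPairing d J (v ∘ ι) := by
  simp [shiftPoly, shiftPairing]

theorem isWeightedHomogeneous_pairingPoly {τ : Type*} (ι : Fin r → τ) (d : Fin (r + 3) → ℂ)
    (J : Fin r → Fin (r + 3)) {w : τ → ℕ} {k : ℕ} (h : ∀ a, w (ι a) = k) :
    IsWeightedHomogeneous w (X.pairingPoly ι d J) k := by
  refine IsWeightedHomogeneous.sum _ _ _ fun a _ => ?_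
  have := isWeightedHomogeneous_X (R := ℂ) w (ι a)
  rw [h] at this
  exact this.C_mul _

theorem isWeightedHomogeneous_shiftPoly {τ : Type*} (ι : X.compactDivisors → τ)
    (d : Fin (r + 3) → ℂ) (J : Fin r → Fin (r + 3)) {w : τ → ℕ} {k : ℕ}
    (h : ∀ a, w (ι a) = k) : IsWeightedHomogeneous w (X.shiftPoly ι d J) k := by
  refine IsWeightedHomogeneous.sum _ _ _ fun a _ => ?_
  have := isWeightedHomogeneous_X (R := ℂ) w (ι a)
  rw [h] at this
  exact this.C_mul _

/-- The product of the determinant and the weights at the vertex `J`. -/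
noncomputable def eulerClass (X : ToricCY3 r) (d : Fin (r + 3) → ℂ) (J : Fin r → Fin (r + 3)) :
    ℂ :=
  ((|(X.Qsub J).det| : ℤ) : ℂ) * ∏ i ∈ co J, X.weight J i d

/-- The cubic shift polynomial, in terms of the fixed points. -/
noncomputable def cubicPoly (X : ToricCY3 r) (d : Fin (r + 3) → ℂ) :
    MvPolynomial (Fin r ⊕ X.compactDivisors) ℂ :=
  ∑ J ∈ X.vertices, C (1 / (6 * X.eulerClass d J)) * (X.pairingPoly Sum.inl d J ^ 3
    - (X.pairingPoly Sum.inl d J + X.shiftPoly Sum.inr d J) ^ 3)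

/-- The polynomial `c_2 / 12` in the `x_i`. -/
noncomputable def c2Poly (N : ℕ) : MvPolynomial (Fin N) ℂ :=
  C (1 / 12) * ∑ i, ∑ j ∈ Finset.Ioi i, MvPolynomial.X i * MvPolynomial.X j

/-- The linear shift polynomial, in terms of the fixed points. -/
noncomputable def linearPoly (X : ToricCY3 r) (d : Fin (r + 3) → ℂ) :
    MvPolynomial X.compactDivisors ℂ :=
  ∑ J ∈ X.vertices, C (eval (fun i => X.weight J i d) (c2Poly (r + 3)) / X.eulerClass d J)
    * -X.shiftPoly id d J

theorem eval_cubicPoly (d : Fin (r + 3) → ℂ) (t : Fin r → ℂ) (m : X.compactDivisors → ℂ) :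
    eval (Sum.elim t m) (X.cubicPoly d) = ∑ J ∈ X.vertices, 1 / (6 * X.eulerClass d J) *
      (X.pairing J t d ^ 3 - (X.pairing J t d + X.shiftPairing d J m) ^ 3) := by
  simp [cubicPoly, eval_pairingPoly, eval_shiftPoly]

theorem eval_linearPoly (d : Fin (r + 3) → ℂ) (m : X.compactDivisors → ℂ) :
    eval m (X.linearPoly d) = ∑ J ∈ X.vertices,
      eval (fun i => X.weight J i d) (c2Poly (r + 3)) / X.eulerClass d J
        * -X.shiftPairing d J m := by
  simp [linearPoly, eval_shiftPoly]

theorem isHomogeneous_c2Poly (N : ℕ) : (c2Poly N).IsHomogeneous 2 := by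
  refine IsHomogeneous.C_mul (IsHomogeneous.sum _ _ _ fun i _ => IsHomogeneous.sum _ _ _
    fun j _ => ?_) _
  exact (isHomogeneous_X ℂ i).mul (isHomogeneous_X ℂ j)

/-- The case of numerator 1, so k = 3. Any admissible `d` serves, and by `IsCubicShift.unique` the
polynomial does not depend on the choice. -/
theorem isCubicShift_cubicPoly (hX : X.compactDivisors.Nonempty) {d : Fin (r + 3) → ℂ}
    (hd : X.Admissible d) : X.IsCubicShift (X.cubicPoly d) := by
  constructor
  · refine IsHomogeneous.sum _ _ _ fun J _ => IsHomogeneous.C_mul ?_ _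
    have h1 : (X.pairingPoly (Sum.inl : _ → Fin r ⊕ X.compactDivisors) d J).IsHomogeneous 1 :=
      isWeightedHomogeneous_pairingPoly _ d J fun _ => rfl
    have h2 : (X.shiftPoly (Sum.inr : _ → Fin r ⊕ X.compactDivisors) d J).IsHomogeneous 1 :=
      isWeightedHomogeneous_shiftPoly _ d J fun _ => rfl
    exact (h1.pow 3).sub ((h1.add h2).pow 3)
  · intro t m
    refine (isOε_jkIntegral_shift (k := 3) hX (isHomogeneous_one _ _) rfl hd t m).congr fun ε => ?_
    simp only [map_one, mul_one, vol, eval_cubicPoly]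
    refine congrArg _ (sum_congr rfl fun J _ => ?_)
    rw [pairing_add, shiftPairing_eq, eulerClass,
      show (Nat.factorial 3 : ℂ) = 6 by norm_num [Nat.factorial]]
    generalize ((|(X.Qsub J).det| : ℤ) : ℂ) * ∏ i ∈ co J, X.weight J i d = D
    rw [one_div, mul_inv]
    ring

theorem c2Vol_eq (ε : Fin (r + 3) → ℂ) (t : Fin r → ℂ) : X.c2Vol ε t = X.jkIntegral ε
    fun φ => Complex.exp (∑ a, t a * φ a) * eval (X.x ε φ) (c2Poly (r + 3)) := by
  rw [c2Vol, jkIntegral_eq, jkIntegral_eq, mul_sum]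
  refine sum_congr rfl fun J _ => ?_
  simp only [c2, c2Poly, map_mul, eval_C, map_sum, eval_X]
  ring

theorem isLinearShift_linearPoly (hX : X.compactDivisors.Nonempty) {d : Fin (r + 3) → ℂ}
    (hd : X.Admissible d) : X.IsLinearShift (X.linearPoly d) := by
  constructor
  · refine IsHomogeneous.sum _ _ _ fun J _ => IsHomogeneous.C_mul ?_ _
    have h2 : (X.shiftPoly id d J).IsHomogeneous 1 :=
      isWeightedHomogeneous_shiftPoly _ d J fun _ => rfl
    exact h2.neg
  · intro t m
    refine (isOε_jkIntegral_shift (k := 1) hX (isHomogeneous_c2Poly _) rfl hd t m).congr fun ε => ?_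
    simp only [c2Vol_eq, eval_linearPoly]
    refine congrArg _ (sum_congr rfl fun J _ => ?_)
    rw [pairing_add, shiftPairing_eq, eulerClass, Nat.factorial_one, Nat.cast_one]
    ring

/-- Polynomial solutions of the shift equations. -/
theorem exists_truncation (d : Fin (r + 3) → ℂ) :
    ∃ F C : MvPolynomial (Fin r) ℂ, ∀ t m,
      eval t F - eval (t + X.ψ m) F = eval (Sum.elim t m) (X.cubicPoly d) ∧
      eval t C - eval (t + X.ψ m) C = eval m (X.linearPoly d) := by
  -- The truncations are the terms of the fixed-point sums at `d` that are cubic, respectively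
  -- linear, in t.
  refine ⟨∑ J ∈ X.vertices, C (1 / (6 * X.eulerClass d J)) * X.pairingPoly id d J ^ 3,
    ∑ J ∈ X.vertices, C (eval (fun i => X.weight J i d) (c2Poly (r + 3)) / X.eulerClass d J)
      * X.pairingPoly id d J, fun t m => ⟨?_, ?_⟩⟩
  · simp only [map_sum, map_mul, eval_C, map_pow, eval_pairingPoly, Function.comp_id,
      eval_cubicPoly, ← sum_sub_distrib, pairing_add, shiftPairing_eq, mul_sub]
  · simp only [map_sum, map_mul, eval_C, eval_pairingPoly, Function.comp_id,
      eval_linearPoly, ← sum_sub_distrib, pairing_add, shiftPairing_eq]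
    exact sum_congr rfl fun _ _ => by ring

/-! ### Bihomogeneous parts -/

theorem bidegreePart_add {A B : Type*} (p q : ℕ) (P P' : MvPolynomial (A ⊕ B) ℂ) :
    bidegreePart p q (P + P') = bidegreePart p q P + bidegreePart p q P' := by
  simp only [bidegreePart, map_add]

theorem bidegreePart_sum {A B ι : Type*} (p q : ℕ) (s : Finset ι)
    (P : ι → MvPolynomial (A ⊕ B) ℂ) :
    bidegreePart p q (∑ i ∈ s, P i) = ∑ i ∈ s, bidegreePart p q (P i) := by
  simp only [bidegreePart, map_sum]

theorem bidegreePart_same {A B : Type*} {p q : ℕ} {P : MvPolynomial (A ⊕ B) ℂ}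
    (h1 : IsWeightedHomogeneous (Sum.elim (fun _ => 1) (fun _ => 0) : A ⊕ B → ℕ) P p)
    (h2 : IsWeightedHomogeneous (Sum.elim (fun _ => 0) (fun _ => 1) : A ⊕ B → ℕ) P q) :
    bidegreePart p q P = P := by
  rw [bidegreePart, h2.weightedHomogeneousComponent_same, h1.weightedHomogeneousComponent_same]

theorem bidegreePart_ne {A B : Type*} {p q q' : ℕ} {P : MvPolynomial (A ⊕ B) ℂ}
    (h2 : IsWeightedHomogeneous (Sum.elim (fun _ => 0) (fun _ => 1) : A ⊕ B → ℕ) P q')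
    (hne : q ≠ q') : bidegreePart p q P = 0 := by
  rw [bidegreePart, h2.weightedHomogeneousComponent_ne _ hne, map_zero]

/-- The pure cube of `U` cancels and one monomial remains in each of the bidegrees (2,1), (1,2),
(0,3). The trivial exponents keep the three terms in one shape. -/
theorem cube_sub_cube {σ : Type*} (U V : MvPolynomial σ ℂ) (c : ℂ) :
    C c * (U ^ 3 - (U + V) ^ 3) = C (-3 * c) * (U ^ 2 * V ^ 1) + (C (-3 * c) * (U ^ 1 * V ^ 2)
      + C (-c) * (U ^ 0 * V ^ 3)) := by
  simp only [map_mul, map_neg, map_ofNat]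
  ring

theorem isWeightedHomogeneous_monomial_left {σ : Type*} {w : σ → ℕ} {U V : MvPolynomial σ ℂ}
    (hU : IsWeightedHomogeneous w U 1) (hV : IsWeightedHomogeneous w V 0) (c : ℂ) (p q : ℕ) :
    IsWeightedHomogeneous w (C c * (U ^ p * V ^ q)) p := by
  simpa using ((hU.pow p).mul (hV.pow q)).C_mul c

theorem isWeightedHomogeneous_monomial_right {σ : Type*} {w : σ → ℕ} {U V : MvPolynomial σ ℂ}
    (hU : IsWeightedHomogeneous w U 0) (hV : IsWeightedHomogeneous w V 1) (c : ℂ) (p q : ℕ) :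
    IsWeightedHomogeneous w (C c * (U ^ p * V ^ q)) q := by
  simpa using ((hU.pow p).mul (hV.pow q)).C_mul c

theorem eval_bidegreePart_cubicPoly (d : Fin (r + 3) → ℂ) (t : Fin r → ℂ)
    (m : X.compactDivisors → ℂ) :
    eval (Sum.elim t m) (bidegreePart 1 2 (X.cubicPoly d))
      = ∑ J ∈ X.vertices, 1 / (6 * X.eulerClass d J) *
        (-3 * X.pairing J t d * X.shiftPairing d J m ^ 2) ∧
    eval (Sum.elim t m) (bidegreePart 0 3 (X.cubicPoly d))
      = ∑ J ∈ X.vertices, 1 / (6 * X.eulerClass d J) * -X.shiftPairing d J m ^ 3 := by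
  have hU1 : ∀ J, IsWeightedHomogeneous (Sum.elim (fun _ => 1) (fun _ => 0) : _ → ℕ)
      (X.pairingPoly (Sum.inl : _ → Fin r ⊕ X.compactDivisors) d J) 1 := fun J =>
    isWeightedHomogeneous_pairingPoly _ d J fun _ => rfl
  have hU2 : ∀ J, IsWeightedHomogeneous (Sum.elim (fun _ => 0) (fun _ => 1) : _ → ℕ)
      (X.pairingPoly (Sum.inl : _ → Fin r ⊕ X.compactDivisors) d J) 0 := fun J =>
    isWeightedHomogeneous_pairingPoly _ d J fun _ => rfl
  have hV1 : ∀ J, IsWeightedHomogeneous (Sum.elim (fun _ => 1) (fun _ => 0) : _ → ℕ)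
      (X.shiftPoly (Sum.inr : _ → Fin r ⊕ X.compactDivisors) d J) 0 := fun J =>
    isWeightedHomogeneous_shiftPoly _ d J fun _ => rfl
  have hV2 : ∀ J, IsWeightedHomogeneous (Sum.elim (fun _ => 0) (fun _ => 1) : _ → ℕ)
      (X.shiftPoly (Sum.inr : _ → Fin r ⊕ X.compactDivisors) d J) 1 := fun J =>
    isWeightedHomogeneous_shiftPoly _ d J fun _ => rfl
  have h1 := fun J => isWeightedHomogeneous_monomial_left (hU1 J) (hV1 J)
  have h2 := fun J => isWeightedHomogeneous_monomial_right (hU2 J) (hV2 J)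
  constructor
  · rw [cubicPoly, bidegreePart_sum, map_sum]
    refine sum_congr rfl fun J _ => ?_
    rw [cube_sub_cube, bidegreePart_add, bidegreePart_add, bidegreePart_same (h1 J _ 1 2)
      (h2 J _ 1 2), bidegreePart_ne (h2 J _ 2 1) (by norm_num),
      bidegreePart_ne (h2 J _ 0 3) (by norm_num)]
    simp only [zero_add, add_zero, map_mul, map_pow, eval_C, eval_pairingPoly, eval_shiftPoly,
      Sum.elim_comp_inl, Sum.elim_comp_inr]
    ring
  · rw [cubicPoly, bidegreePart_sum, map_sum]
    refine sum_congr rfl fun J _ => ?_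
    rw [cube_sub_cube, bidegreePart_add, bidegreePart_add, bidegreePart_same (h1 J _ 0 3)
      (h2 J _ 0 3), bidegreePart_ne (h2 J _ 2 1) (by norm_num),
      bidegreePart_ne (h2 J _ 1 2) (by norm_num)]
    simp only [zero_add, map_mul, map_pow, eval_C, eval_pairingPoly, eval_shiftPoly,
      Sum.elim_comp_inl, Sum.elim_comp_inr]
    ring

/-! ### Factorization -/

theorem shiftPairing_shift {n : ℕ} (d : Fin (r + 3) → ℂ) (J : Fin r → Fin (r + 3)) (e g : ℂ)
    (α : Fin n → X.compactDivisors → ℂ) (p : Fin n) :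
    X.shiftPairing d J (gp e g p • α p + (e / 2) • X.sigma α p)
      = shiftScalar e g (fun p => X.shiftPairing d J (α p)) p := by
  simp only [shiftScalar, sigma, map_add, map_smul, map_sub, map_sum, smul_eq_mul]

/-- The part of the factorization identity that involves the shift polynomials only. -/
theorem shift_factorization {n : ℕ} (hn : 1 ≤ n) (d : Fin (r + 3) → ℂ) {e g : ℂ}
    (h : ∀ p : Fin n, (e / 2) ^ 2 - gp e g p ^ 2 ≠ 0) {α : Fin n → X.compactDivisors → ℂ}
    (hα : ∑ p, α p = 0) (t : Fin r → ℂ) :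
    ∑ p, eval (Sum.elim t (α p)) (bidegreePart 1 2 (X.cubicPoly d))
      + g * ∑ p, eval (Sum.elim t (α p)) (bidegreePart 0 3 (X.cubicPoly d))
      + e / 2 * ∑ p, ∑ q ∈ Finset.Iio p,
        X.quantumShift (X.cubicPoly d) (X.linearPoly d) 0 (α q - α p)
    = -∑ p, eval (Sum.elim t (gp e g p • α p + (e / 2) • X.sigma α p)) (X.cubicPoly d)
          / ((e / 2) ^ 2 - gp e g p ^ 2)
      + 1 / 2 * ∑ p, eval (gp e g p • α p + (e / 2) • X.sigma α p) (X.linearPoly d) := by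
  have hα' : ∀ J, ∑ p, X.shiftPairing d J (α p) = 0 := fun J => by
    rw [← map_sum, hα, map_zero]
  have hz : ∀ J, X.pairing J (0 : Fin r → ℂ) d = 0 := fun J => by simp [pairing_apply]
  -- The scalar identities hold at each vertex; they are weighted by the fixed-point coefficients
  -- and summed.
  have hc := sum_congr (rfl : X.vertices = X.vertices) fun J _ =>
    congrArg (1 / (6 * X.eulerClass d J) * ·)
      (cubic_factorization (e := e) (g := g) hn h (hα' J) (X.pairing J t d))
  have hl := sum_congr (rfl : X.vertices = X.vertices) fun J _ =>
    congrArg (eval (fun i => X.weight J i d) (c2Poly (r + 3)) / X.eulerClass d J * -·)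
      (linear_factorization (e := e) (g := g) (hα' J))
  simp only [mul_zero, sum_const_zero, mul_add, sum_add_distrib] at hc
  have h1 : ∑ p, eval (Sum.elim t (α p)) (bidegreePart 1 2 (X.cubicPoly d))
      = ∑ J ∈ X.vertices, 1 / (6 * X.eulerClass d J)
        * ∑ p, -3 * X.pairing J t d * X.shiftPairing d J (α p) ^ 2 := by
    simp only [(eval_bidegreePart_cubicPoly d _ _).1, mul_sum]
    exact sum_comm
  have h2 : g * ∑ p, eval (Sum.elim t (α p)) (bidegreePart 0 3 (X.cubicPoly d))
      = ∑ J ∈ X.vertices, 1 / (6 * X.eulerClass d J)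
        * (g * ∑ p, -X.shiftPairing d J (α p) ^ 3) := by
    simp only [(eval_bidegreePart_cubicPoly d _ _).2, mul_sum]
    rw [sum_comm]
    exact sum_congr rfl fun _ _ => sum_congr rfl fun _ _ => by ring
  have h3 : e / 2 * ∑ p, ∑ q ∈ Finset.Iio p,
        X.quantumShift (X.cubicPoly d) (X.linearPoly d) 0 (α q - α p)
      = ∑ J ∈ X.vertices, 1 / (6 * X.eulerClass d J) * (e / 2 * ∑ p, ∑ q ∈ Finset.Iio p,
          -(X.shiftPairing d J (α q) - X.shiftPairing d J (α p)) ^ 3)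
        + ∑ J ∈ X.vertices, eval (fun i => X.weight J i d) (c2Poly (r + 3)) / X.eulerClass d J
          * -(e / 2 * ∑ p, ∑ q ∈ Finset.Iio p,
            (X.shiftPairing d J (α q) - X.shiftPairing d J (α p))) := by
    have key : ∀ (c : (Fin r → Fin (r + 3)) → ℂ) (f : (Fin r → Fin (r + 3)) → Fin n → Fin n → ℂ),
        e / 2 * ∑ p, ∑ q ∈ Finset.Iio p, ∑ J ∈ X.vertices, c J * f J p q
          = ∑ J ∈ X.vertices, c J * (e / 2 * ∑ p, ∑ q ∈ Finset.Iio p, f J p q) := fun c f => by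
      rw [sum_congr rfl fun p _ => sum_comm, sum_comm, mul_sum]
      refine sum_congr rfl fun J _ => ?_
      simp only [mul_sum]
      exact sum_congr rfl fun _ _ => sum_congr rfl fun _ _ => by ring
    have h0 : ∀ y : ℂ, 0 ^ 3 - (0 + y) ^ 3 = -y ^ 3 := fun y => by ring
    simp only [quantumShift, eval_cubicPoly, eval_linearPoly, hz, h0, map_sub, sum_add_distrib,
      mul_add, key, sum_neg_distrib, mul_neg]
  have h4 : ∑ p, eval (Sum.elim t (gp e g p • α p + (e / 2) • X.sigma α p)) (X.cubicPoly d)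
          / ((e / 2) ^ 2 - gp e g p ^ 2)
      = ∑ J ∈ X.vertices, 1 / (6 * X.eulerClass d J) * ∑ p, (X.pairing J t d ^ 3
        - (X.pairing J t d + shiftScalar e g (fun p => X.shiftPairing d J (α p)) p) ^ 3)
          / ((e / 2) ^ 2 - gp e g p ^ 2) := by
    simp only [eval_cubicPoly, shiftPairing_shift, mul_sum, sum_div, mul_div_assoc]
    exact sum_comm
  have h5 : 1 / 2 * ∑ p, eval (gp e g p • α p + (e / 2) • X.sigma α p) (X.linearPoly d)
      = ∑ J ∈ X.vertices, eval (fun i => X.weight J i d) (c2Poly (r + 3)) / X.eulerClass d J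
        * -(1 / 2 * ∑ p, shiftScalar e g (fun p => X.shiftPairing d J (α p)) p) := by
    simp only [eval_linearPoly, shiftPairing_shift, mul_sum, ← sum_neg_distrib]
    rw [sum_comm]
    exact sum_congr rfl fun _ _ => sum_congr rfl fun _ _ => by ring
  rw [h1, h2, h3, h4, h5]
  linear_combination hc + hl

/-- The factorization defect is a combination of the defects of the shift equations. -/
theorem factorizationDefect_eq {n : ℕ} (hn : 1 ≤ n) (d : Fin (r + 3) → ℂ) {e g : ℂ}
    (h : ∀ p : Fin n, (e / 2) ^ 2 - gp e g p ^ 2 ≠ 0) {α : Fin n → X.compactDivisors → ℂ}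
    (hα : ∑ p, α p = 0) (t : Fin r → ℂ) (F C : (Fin r → ℂ) → ℂ) :
    X.factorizationDefect (X.cubicPoly d) (X.linearPoly d) F C e n α g t
    = ∑ p, 1 / ((e / 2) ^ 2 - gp e g p ^ 2) * (F t - F (X.tp e g α t p)
        - eval (Sum.elim t (gp e g p • α p + (e / 2) • X.sigma α p)) (X.cubicPoly d))
      + ∑ p, -1 / 2 * (C t - C (X.tp e g α t p)
        - eval (gp e g p • α p + (e / 2) • X.sigma α p) (X.linearPoly d)) := by
  have h1 : ∀ (g' : ℂ) (t' : Fin r → ℂ), X.classicalAction (X.cubicPoly d) F C e 1 0 g' t'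
      = 1 / ((e / 2) ^ 2 - g' ^ 2) * F t' + -1 / 2 * C t' := fun g' t' => by
    simp only [classicalAction, (eval_bidegreePart_cubicPoly d _ _).1,
      (eval_bidegreePart_cubicPoly d _ _).2, Pi.zero_apply, map_zero]
    simp
    ring
  have h2 := shift_factorization hn d h hα t
  -- This matches the coefficient of F(t) in u_n with the sum of those in the u_1 terms.
  have h3 := sum_inv_den hn h
  simp only [factorizationDefect, h1]
  simp only [classicalAction]
  simp only [mul_sub, sum_sub_distrib, sum_add_distrib, ← sum_mul, ← mul_sum, h3]
  simp only [one_div_mul_eq_div, sum_const, card_univ, Fintype.card_fin, nsmul_eq_mul]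
  linear_combination h2

end ToricCY3
-- The main theorem.
theorem mainTheorem3 {r : ℕ} (X : ToricCY3 r) (hX : X.compactDivisors.Nonempty) :
    -- the shift polynomials exist and are unique
    (∃! P₃, X.IsCubicShift P₃) ∧ (∃! P₁, X.IsLinearShift P₁) ∧
    ∀ P₃ P₁, X.IsCubicShift P₃ → X.IsLinearShift P₁ →
      -- the shift equations have exact solutions (truncations)
      (∃ F' C' : MvPolynomial (Fin r) ℂ, ∀ t m,
        MvPolynomial.eval t F' - MvPolynomial.eval (t + X.ψ m) F' =
          MvPolynomial.eval (Sum.elim t m) P₃ ∧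
        MvPolynomial.eval t C' - MvPolynomial.eval (t + X.ψ m) C' =
          MvPolynomial.eval m P₁) ∧
      -- factorization, for all couplings for which no denominator vanishes
      ∀ (n : ℕ) (_ : 1 ≤ n) (α : Fin n → X.compactDivisors → ℂ) (_ : ∑ p, α p = 0) (e g : ℂ)
        (_ : (n * e / 2) ^ 2 - g ^ 2 ≠ 0)
        (_ : ∀ p : Fin n, (e / 2) ^ 2 - ToricCY3.gp e g p ^ 2 ≠ 0) (t : Fin r → ℂ),
        X.IsOε (fun ε => X.factorizationDefect P₃ P₁ (X.vol ε) (X.c2Vol ε) e n α g t) ∧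
        -- exactness, for truncations `F`, `C` given on a domain `U` (such as a chamber)
        ∀ (F C : (Fin r → ℂ) → ℂ) (U : Set (Fin r → ℂ)),
          (∀ s ∈ U, ∀ m, s + X.ψ m ∈ U →
            F s - F (s + X.ψ m) = MvPolynomial.eval (Sum.elim s m) P₃) →
          (∀ s ∈ U, ∀ m, s + X.ψ m ∈ U →
            C s - C (s + X.ψ m) = MvPolynomial.eval m P₁) →
          t ∈ U → (∀ p, X.tp e g α t p ∈ U) →
          X.factorizationDefect P₃ P₁ F C e n α g t = 0 :=  by
  obtain ⟨d, hd⟩ := ToricCY3.exists_admissible hX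
  have h3 := ToricCY3.isCubicShift_cubicPoly hX hd
  have h1 := ToricCY3.isLinearShift_linearPoly hX hd
  refine ⟨⟨_, h3, fun P h => h.unique hX h3⟩, ⟨_, h1, fun P h => h.unique hX h1⟩, ?_⟩
  intro P₃ P₁ hP₃ hP₁
  -- By uniqueness the given polynomials are the explicit fixed-point sums at `d`.
  obtain rfl := hP₃.unique hX h3
  obtain rfl := hP₁.unique hX h1
  refine ⟨ToricCY3.exists_truncation d, ?_⟩
  intro n hn α hα e g _ hgp t
  refine ⟨?_, ?_⟩
  · refine ((ToricCY3.IsOε.sum fun p _ => (h3.2 t _).const_mul _).add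
      (ToricCY3.IsOε.sum fun p _ => (h1.2 t _).const_mul _)).congr fun ε =>
        ToricCY3.factorizationDefect_eq hn d hgp hα t (X.vol ε) (X.c2Vol ε)
  · intro F C U hF hC ht htp
    rw [ToricCY3.factorizationDefect_eq hn d hgp hα t F C,
      Finset.sum_eq_zero fun p _ => ?_, Finset.sum_eq_zero fun p _ => ?_, add_zero]
    · rw [← hC t ht _ (htp p), ToricCY3.tp, sub_self, mul_zero]
    · rw [← hF t ht _ (htp p), ToricCY3.tp, sub_self, mul_zero]
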